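/- Let $\Omega\subset\mathbb R^d$ be open and $s\in(0,1]$. Let $A:\mathbb R^d\times[0,\infty)\to[0,\infty)$ be a generalized $\Phi$-function: $x\mapsto A(x,|h(x)|)$ is measurable for every measurable $h$, and for a.e. $x$ the function $A(x,\cdot)$ is increasing (in the non-strict sense) and convex, with $A(x,0)=0$, $\lim_{\ell\to0^+}A(x,\ell)=0$ and $\lim_{\ell\to\infty}A(x,\ell)=\infty$. Assume that $A$ satisfies $(\mathrm{Dec})_q$ for some $q<\infty$, i.e. $\ell\mapsto A(x,\ell)/\ell^q$ is decreasing on $(0,\infty)$ for a.e. $x$. Let $A'(x,\ell)=\sup_{r\ge0}\big(r\ell-A(x,r)\big)\in[0,\infty]$ be the conjugate of $A$. For $B\in\{A,A'\}$ and $U\in\{\Omega,\mathbb R^d\}$ let $L^{B}(U;\mathbb R^m)$ be the space of measurable $h:U\to\mathbb R^m$ (up to a.e. equality) with $\int_U B(x,\rho|h(x)|)\,dx<\infty$ for some $\rho>0$, and let $\|h\|_{L^{A}(\mathbb R^d;\mathbb R^m)}=\inf\{\rho>0:\int_{\mathbb R^d} A(x,|h(x)|/\rho)\,dx\le1\}$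 be the Luxemburg norm. For $\varphi\in C_c^\infty(\Omega)$, extended by $0$ to $\mathbb R^d$, let $D^s\varphi=D(I_{1-s}\varphi)$ be the Riesz fractional gradient, where $I_0\varphi=\varphi$ and, for $0<s<1$, $$I_{1-s}\varphi(x)=\frac{\mu(d,s)}{d+s-1}\int_{\mathbb R^d}\frac{\varphi(y)}{|x-y|^{d+s-1}}\,dy,\qquad \mu(d,s)=\frac{2^s\,\Gamma\left(\frac{d+s+1}{2}\right)}{\pi^{d/2}\,\Gamma\left(\frac{1-s}{2}\right)}.$$ Let $\Lambda^{s,A}_0(\Omega)$ be the completion of the space of those $\varphi\in C_c^\infty(\Omega)$ for which $\|\varphi\|_{L^A(\mathbb R^d)}+\|D^s\varphi\|_{L^A(\mathbb R^d;\mathbb R^d)}$ is finite, with respect to this norm, realized as the closure of $\{(\varphi,D^s\varphi)\}$ in $L^A(\mathbb R^d)\times L^A(\mathbb R^d;\mathbb R^d)$. (If there is $\beta\in(0,1]$ with $A(x,\beta)\le1\le A(x,1/\beta)$ for a.e. $x$, then these are all $\varphi\in C_c^\infty(\Omega)$.) For $g\in\Lambda^{s,A}_0(\Omega)$, let $D^sg\in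 L^A(\mathbb R^d;\mathbb R^d)$ be the limit of $D^s\varphi_n$ for test functions $\varphi_n\to g$ in $\Lambda^{s,A}_0(\Omega)$. Let $\Lambda^{-s,A'}(\Omega)$ be the dual of $\Lambda^{s,A}_0(\Omega)$. Then for every $F\in\Lambda^{-s,A'}(\Omega)$ there exist $f\in L^{A'}(\Omega)$ and $\boldsymbol f\in L^{A'}(\mathbb R^d;\mathbb R^d)$ such that, for all $g\in\Lambda^{s,A}_0(\Omega)$, the functions $fg$ and $\boldsymbol f\cdot D^sg$ are integrable over $\Omega$ and $\mathbb R^d$ respectively, and $$\langle F,g\rangle=\int_\Omega f\,g\,dx+\int_{\mathbb R^d}\boldsymbol f\cdot D^sg\,dx.$$ -/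

import Mathlib

open MeasureTheory Set Filter Topology
open scoped NNReal ENNReal Gradient Distributions

noncomputable section

/-! ### Generalized `Φ`-functions on `ℝ^d` -/

/-- A generalized `Φ`-function `A : ℝ^d × [0,∞) → [0,∞)`. Measurability means Lebesgue
measurability, i.e. a.e.-measurability with respect to `volume`; quantifying over all measurable
`f ≥ 0` is the same as quantifying over `|f|` for all measurable scalar or vector-valued `f`. -/
structure PhiFunction (d : ℕ) where
  toFun : EuclideanSpace ℝ (Fin d) → ℝ≥0 → ℝ≥0
  aemeasurable_comp : ∀ f : EuclideanSpace ℝ (Fin d) → ℝ≥0, Measurable f →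
    AEMeasurable (fun x => toFun x (f x)) volume
  ae_monotone : ∀ᵐ x, Monotone (toFun x)
  ae_convexOn : ∀ᵐ x, ConvexOn ℝ≥0 univ (toFun x)
  ae_zero : ∀ᵐ x, toFun x 0 = 0
  ae_tendsto_zero : ∀ᵐ x, Tendsto (toFun x) (𝓝[>] 0) (𝓝 0)
  ae_tendsto_atTop : ∀ᵐ x, Tendsto (toFun x) atTop atTop

namespace PhiFunction

variable {d : ℕ}

/-- The `Φ`-function as a `[0,∞]`-valued function. -/
def toENN (A : PhiFunction d) : EuclideanSpace ℝ (Fin d) → ℝ≥0 → ℝ≥0∞ :=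
  fun x l => (A.toFun x l : ℝ≥0∞)

/-- The growth condition `(Dec)_q`: for a.e. `x`, the function `ℓ ↦ A(x,ℓ) / ℓ^q` is decreasing
on `(0,∞)`. -/
def Dec (A : PhiFunction d) (q : ℝ) : Prop :=
  ∀ᵐ x, AntitoneOn (fun l : ℝ≥0 => A.toFun x l / l ^ q) (Ioi 0)

/-- The conjugate `A'(x,ℓ) = sup_{r ≥ 0} (r ℓ - A(x,r)) ∈ [0,∞]`. (Negative values are replaced by
`0`, which does not change the supremum as `r = 0` gives the value `0` for a.e. `x`.) -/
def conj (A : PhiFunction d) : EuclideanSpace ℝ (Fin d) → ℝ≥0 → ℝ≥0∞ :=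
  fun x l => ⨆ r : ℝ≥0, ENNReal.ofReal ((r : ℝ) * l - A.toFun x r)

end PhiFunction

/-! ### Generalized Orlicz spaces -/

section Orlicz

variable {d : ℕ} {F : Type*} [NormedAddCommGroup F]

/-- The modular `∫ B(x, |f(x)|) dμ(x)`. -/
def orliczModular (B : EuclideanSpace ℝ (Fin d) → ℝ≥0 → ℝ≥0∞) (f : EuclideanSpace ℝ (Fin d) → F)
    (μ : Measure (EuclideanSpace ℝ (Fin d))) : ℝ≥0∞ :=
  ∫⁻ x, B x ‖f x‖₊ ∂μ

/-- `f` belongs to the generalized Orlicz class of `B`: it is measurable and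
`∫ B(x, |ρ f(x)|) dμ(x) < ∞` for some `ρ > 0`. For an open set `Ω`, membership in `L^B(Ω)` is the
case `μ = volume.restrict Ω`. -/
def MemOrlicz [NormedSpace ℝ F] (B : EuclideanSpace ℝ (Fin d) → ℝ≥0 → ℝ≥0∞)
    (f : EuclideanSpace ℝ (Fin d) → F) (μ : Measure (EuclideanSpace ℝ (Fin d))) : Prop :=
  AEStronglyMeasurable f μ ∧ ∃ ρ : ℝ, 0 < ρ ∧ orliczModular B (ρ • f) μ < ∞

/-- The Luxemburg norm `inf {ρ > 0 : ∫ B(x, |f(x) / ρ|) dμ(x) ≤ 1}`. -/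
def luxemburgNorm [NormedSpace ℝ F] (B : EuclideanSpace ℝ (Fin d) → ℝ≥0 → ℝ≥0∞)
    (f : EuclideanSpace ℝ (Fin d) → F) (μ : Measure (EuclideanSpace ℝ (Fin d))) : ℝ :=
  sInf {ρ : ℝ | 0 < ρ ∧ orliczModular B (ρ⁻¹ • f) μ ≤ 1}

lemma orliczModular_congr {B : EuclideanSpace ℝ (Fin d) → ℝ≥0 → ℝ≥0∞}
    {f g : EuclideanSpace ℝ (Fin d) → F} {μ : Measure (EuclideanSpace ℝ (Fin d))}
    (h : f =ᵐ[μ] g) : orliczModular B f μ = orliczModular B g μ := by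
  refine lintegral_congr_ae ?_
  filter_upwards [h] with x hx
  rw [hx]

namespace PhiFunction

variable (A : PhiFunction d)

lemma aemeasurable_modular {f : EuclideanSpace ℝ (Fin d) → F} (hf : StronglyMeasurable f) :
    AEMeasurable (fun x => A.toENN x ‖f x‖₊) volume :=
  (A.aemeasurable_comp _ hf.nnnorm.measurable).coe_nnreal_ennreal

lemma modular_convex [NormedSpace ℝ F] {f g : EuclideanSpace ℝ (Fin d) → F}
    (hf : StronglyMeasurable f) (a b : ℝ≥0) (hab : a + b = 1) :
    orliczModular A.toENN ((a : ℝ) • f + (b : ℝ) • g) volume ≤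
      a * orliczModular A.toENN f volume + b * orliczModular A.toENN g volume := by
  unfold orliczModular
  rw [← lintegral_const_mul' _ _ ENNReal.coe_ne_top, ← lintegral_const_mul' _ _ ENNReal.coe_ne_top,
    ← lintegral_add_left' ((A.aemeasurable_modular hf).const_mul _)]
  refine lintegral_mono_ae ?_
  filter_upwards [A.ae_monotone, A.ae_convexOn] with x hm hc
  have h1 : ‖((a : ℝ) • f + (b : ℝ) • g) x‖₊ ≤ a • ‖f x‖₊ + b • ‖g x‖₊ := by
    refine (nnnorm_add_le _ _).trans (le_of_eq ?_)
    simp [nnnorm_smul]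
  have h2 := (hm h1).trans (hc.2 (mem_univ ‖f x‖₊) (mem_univ ‖g x‖₊) zero_le zero_le hab)
  unfold toENN
  exact_mod_cast h2

lemma modular_zero [NormedSpace ℝ F] :
    orliczModular A.toENN (0 : EuclideanSpace ℝ (Fin d) → F) volume = 0 := by
  unfold orliczModular
  rw [← lintegral_zero (μ := (volume : Measure (EuclideanSpace ℝ (Fin d))))]
  refine lintegral_congr_ae ?_
  filter_upwards [A.ae_zero] with x hx
  simp [toENN, hx]

lemma modular_smul_le [NormedSpace ℝ F] {f : EuclideanSpace ℝ (Fin d) → F}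
    (hf : StronglyMeasurable f) {t : ℝ≥0} (ht : t ≤ 1) :
    orliczModular A.toENN ((t : ℝ) • f) volume ≤ t * orliczModular A.toENN f volume := by
  have := A.modular_convex (g := (0 : EuclideanSpace ℝ (Fin d) → F)) hf t (1 - t)
    (add_tsub_cancel_of_le ht)
  simpa [A.modular_zero] using this

lemma modular_smul_mono [NormedSpace ℝ F] (f : EuclideanSpace ℝ (Fin d) → F)
    {a b : ℝ} (h : |a| ≤ |b|) :
    orliczModular A.toENN (a • f) volume ≤ orliczModular A.toENN (b • f) volume := by
  refine lintegral_mono_ae ?_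
  filter_upwards [A.ae_monotone] with x hm
  have : ‖(a • f) x‖₊ ≤ ‖(b • f) x‖₊ := by
    rw [← NNReal.coe_le_coe]
    simp only [Pi.smul_apply, coe_nnnorm, norm_smul, Real.norm_eq_abs]
    gcongr
  exact ENNReal.coe_le_coe.2 (hm this)

end PhiFunction

variable [NormedSpace ℝ F]

/-- The vector space underlying `L^A(ℝ^d; F)`; functions are identified when they agree a.e. -/
def orliczSubmodule (A : PhiFunction d) (F : Type*) [NormedAddCommGroup F] [NormedSpace ℝ F] :
    Submodule ℝ (EuclideanSpace ℝ (Fin d) →ₘ[volume] F) where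
  carrier := {f | MemOrlicz A.toENN f volume}
  zero_mem' := by
    refine ⟨AEEqFun.aestronglyMeasurable _, 1, one_pos, ?_⟩
    rw [orliczModular_congr (g := 0), A.modular_zero]
    · simp
    · filter_upwards [AEEqFun.coeFn_zero (α := EuclideanSpace ℝ (Fin d)) (β := F)
        (μ := volume)] with x hx
      simp [hx]
  add_mem' := by
    rintro f g ⟨-, a, ha, hfa⟩ ⟨-, b, hb, hgb⟩
    refine ⟨AEEqFun.aestronglyMeasurable _, min a b / 2, by positivity, ?_⟩
    rw [orliczModular_congr (g := ((1 / 2 : ℝ≥0) : ℝ) • (min a b • ⇑f) +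
      ((1 / 2 : ℝ≥0) : ℝ) • (min a b • ⇑g))]
    · refine (A.modular_convex (f.stronglyMeasurable.const_smul _) _ _ (by norm_num)).trans_lt ?_
      have h1 := (A.modular_smul_mono f (a := min a b) (b := a)
        (by rw [abs_of_pos ha, abs_of_pos (lt_min ha hb)]; exact min_le_left _ _)).trans_lt hfa
      have h2 := (A.modular_smul_mono g (a := min a b) (b := b)
        (by rw [abs_of_pos hb, abs_of_pos (lt_min ha hb)]; exact min_le_right _ _)).trans_lt hgb
      exact ENNReal.add_lt_top.2
        ⟨ENNReal.mul_lt_top ENNReal.coe_lt_top h1, ENNReal.mul_lt_top ENNReal.coe_lt_top h2⟩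
    · filter_upwards [AEEqFun.coeFn_add f g] with x hx
      simp only [Pi.smul_apply, hx, Pi.add_apply, smul_add, smul_smul]
      simp [div_eq_inv_mul]
  smul_mem' := by
    rintro c f ⟨-, a, ha, hfa⟩
    have hc : 0 < 1 + |c| := by positivity
    refine ⟨AEEqFun.aestronglyMeasurable _, a / (1 + |c|), by positivity, ?_⟩
    rw [orliczModular_congr (g := (a / (1 + |c|) * c) • ⇑f)]
    · refine (A.modular_smul_mono f (b := a) ?_).trans_lt hfa
      rw [abs_mul, abs_div, abs_of_pos hc, div_mul_eq_mul_div, div_le_iff₀ hc]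
      gcongr
      linarith
    · filter_upwards [AEEqFun.coeFn_smul c f] with x hx
      simp only [Pi.smul_apply, hx, smul_smul]

/-- The generalized Orlicz space `L^A(ℝ^d; F)`. -/
abbrev OrliczSpace (A : PhiFunction d) (F : Type*) [NormedAddCommGroup F] [NormedSpace ℝ F] :
    Type _ :=
  orliczSubmodule A F

namespace OrliczSpace

variable {A : PhiFunction d}

/-- A representative of an element of `L^A(ℝ^d; F)`. -/
def fn (f : OrliczSpace A F) : EuclideanSpace ℝ (Fin d) → F :=
  ⇑(f : EuclideanSpace ℝ (Fin d) →ₘ[volume] F)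

lemma fn_stronglyMeasurable (f : OrliczSpace A F) : StronglyMeasurable f.fn :=
  AEEqFun.stronglyMeasurable _

lemma fn_add (f g : OrliczSpace A F) : (f + g).fn =ᵐ[volume] f.fn + g.fn :=
  AEEqFun.coeFn_add _ _

lemma fn_smul (c : ℝ) (f : OrliczSpace A F) : (c • f).fn =ᵐ[volume] c • f.fn :=
  AEEqFun.coeFn_smul _ _

lemma fn_zero : (0 : OrliczSpace A F).fn =ᵐ[volume] 0 :=
  AEEqFun.coeFn_zero

instance : Norm (OrliczSpace A F) :=
  ⟨fun f => luxemburgNorm A.toENN f.fn volume⟩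

lemma norm_def (f : OrliczSpace A F) : ‖f‖ = luxemburgNorm A.toENN f.fn volume := rfl

lemma norm_nonneg' (f : OrliczSpace A F) : 0 ≤ ‖f‖ :=
  Real.sInf_nonneg fun _ h => h.1.le

lemma norm_le_of_modular {f : OrliczSpace A F} {ρ : ℝ} (hρ : 0 < ρ)
    (h : orliczModular A.toENN (ρ⁻¹ • f.fn) volume ≤ 1) : ‖f‖ ≤ ρ :=
  csInf_le ⟨0, fun _ h => h.1.le⟩ ⟨hρ, h⟩

lemma exists_modular_le (f : OrliczSpace A F) :
    {ρ : ℝ | 0 < ρ ∧ orliczModular A.toENN (ρ⁻¹ • f.fn) volume ≤ 1}.Nonempty := by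
  obtain ⟨-, a, ha, hfa⟩ := f.2
  lift orliczModular A.toENN (a • ⇑(f : EuclideanSpace ℝ (Fin d) →ₘ[volume] F)) volume to ℝ≥0
    using hfa.ne with M hM
  have hM0 : (0 : ℝ≥0) < 1 + M := by positivity
  refine ⟨((1 + M : ℝ≥0) : ℝ) / a, div_pos (by exact_mod_cast hM0) ha, ?_⟩
  have h1 : (1 + M)⁻¹ ≤ 1 := inv_le_one_of_one_le₀ (by simp)
  have h := A.modular_smul_le (f.fn_stronglyMeasurable.const_smul a) h1
  rw [show (((1 + M : ℝ≥0) : ℝ) / a)⁻¹ • f.fn = (((1 + M)⁻¹ : ℝ≥0) : ℝ) • (a • f.fn) by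
    rw [smul_smul, inv_div, NNReal.coe_inv, div_eq_inv_mul]]
  refine h.trans ?_
  change ((1 + M)⁻¹ : ℝ≥0) * orliczModular A.toENN
    (a • ⇑(f : EuclideanSpace ℝ (Fin d) →ₘ[volume] F)) volume ≤ 1
  rw [← hM, ← ENNReal.coe_mul]
  norm_cast
  rw [inv_mul_le_iff₀ hM0]
  simp

lemma modular_le_one {f : OrliczSpace A F} {ρ : ℝ} (h : ‖f‖ < ρ) :
    orliczModular A.toENN (ρ⁻¹ • f.fn) volume ≤ 1 := by
  obtain ⟨r, ⟨hr, hr1⟩, hrρ⟩ := exists_lt_of_csInf_lt f.exists_modular_le h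
  refine (A.modular_smul_mono _ ?_).trans hr1
  have hρ := hr.trans hrρ
  rw [abs_of_pos (inv_pos.2 hρ), abs_of_pos (inv_pos.2 hr)]
  gcongr

lemma norm_add_le' (f g : OrliczSpace A F) : ‖f + g‖ ≤ ‖f‖ + ‖g‖ := by
  refine le_of_forall_pos_le_add fun ε hε => ?_
  have hf := f.norm_nonneg'
  have hg := g.norm_nonneg'
  lift ‖f‖ + ε / 2 to ℝ≥0 using by positivity with a ha
  lift ‖g‖ + ε / 2 to ℝ≥0 using by positivity with b hb
  have ha0 : (0 : ℝ) < a := by rw [ha]; positivity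
  have hb0 : (0 : ℝ) < b := by rw [hb]; positivity
  have hab : ‖f‖ + ‖g‖ + ε = a + b := by rw [ha, hb]; ring
  rw [hab]
  refine norm_le_of_modular (by positivity) ?_
  have h0 : a + b ≠ 0 := fun h => by
    have : (a : ℝ) + b = 0 := by exact_mod_cast h
    linarith
  have e : ((a : ℝ) + b)⁻¹ • (f + g).fn =ᵐ[volume]
      ((a / (a + b) : ℝ≥0) : ℝ) • ((a : ℝ)⁻¹ • f.fn) +
      ((b / (a + b) : ℝ≥0) : ℝ) • ((b : ℝ)⁻¹ • g.fn) := by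
    filter_upwards [fn_add f g] with x hx
    simp only [Pi.smul_apply, hx, Pi.add_apply, smul_add, smul_smul]
    congr 2 <;> (push_cast; field_simp)
  rw [orliczModular_congr e]
  refine (A.modular_convex (f.fn_stronglyMeasurable.const_smul _) _ _
    (by rw [← add_div, div_self h0])).trans ?_
  have h1 := modular_le_one (f := f) (ρ := a) (by rw [ha]; linarith)
  have h2 := modular_le_one (f := g) (ρ := b) (by rw [hb]; linarith)
  calc _ ≤ ((a / (a + b) : ℝ≥0) : ℝ≥0∞) * 1 + ((b / (a + b) : ℝ≥0) : ℝ≥0∞) * 1 := by gcongr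
    _ = 1 := by
      rw [mul_one, mul_one, ← ENNReal.coe_add, ← add_div, div_self h0, ENNReal.coe_one]

lemma norm_smul_le' (c : ℝ) (f : OrliczSpace A F) : ‖c • f‖ ≤ |c| * ‖f‖ := by
  refine le_of_forall_pos_le_add fun ε hε => ?_
  have hf := f.norm_nonneg'
  set δ := ε / (1 + |c|) with hδ
  have hδ0 : 0 < δ := by positivity
  have h1 : |c| * (‖f‖ + δ) ≤ |c| * ‖f‖ + ε := by
    have : |c| * δ ≤ ε := by
      rw [hδ, mul_div_assoc', div_le_iff₀ (by positivity)]
      nlinarith [abs_nonneg c]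
    linarith [mul_add |c| ‖f‖ δ]
  refine norm_le_of_modular (by positivity) ?_
  rw [orliczModular_congr (g := ((|c| * ‖f‖ + ε)⁻¹ * c) • f.fn)]
  · refine (A.modular_smul_mono _ ?_).trans (modular_le_one (f := f) (ρ := ‖f‖ + δ) (by linarith))
    rw [abs_mul, abs_inv, abs_inv, abs_of_pos (by positivity : 0 < |c| * ‖f‖ + ε),
      abs_of_pos (by positivity : 0 < ‖f‖ + δ), inv_mul_le_iff₀ (by positivity),
      ← div_eq_mul_inv, le_div_iff₀ (by positivity)]
    exact h1
  · filter_upwards [fn_smul c f] with x hx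
    simp only [Pi.smul_apply, hx, smul_smul]

lemma eq_zero_of_norm (f : OrliczSpace A F) (h : ‖f‖ = 0) : f = 0 := by
  have key : ∀ n : ℕ, orliczModular A.toENN ((n : ℝ) • f.fn) volume = 0 := by
    intro n
    refine le_antisymm (ENNReal.le_of_forall_pos_le_add fun ε hε _ => ?_) zero_le
    set t : ℝ≥0 := min ε 1 with ht
    have ht0 : 0 < t := lt_min hε one_pos
    have hm : ∀ ρ : ℝ, 0 < ρ → orliczModular A.toENN (ρ⁻¹ • f.fn) volume ≤ 1 :=
      fun ρ hρ => modular_le_one (h ▸ hρ)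
    have hn : (0 : ℝ) < (n + 1 : ℝ) / t := by positivity
    have h1 := A.modular_smul_le (f.fn_stronglyMeasurable.const_smul ((n + 1 : ℝ) / t))
      (min_le_right ε 1)
    rw [← ht, smul_smul, mul_div_cancel₀ _ (by exact_mod_cast ht0.ne')] at h1
    have h2 := hm _ (inv_pos.2 hn)
    rw [inv_inv] at h2
    have h3 := A.modular_smul_mono f.fn (a := n) (b := n + 1) (by
      rw [abs_of_nonneg (by positivity), abs_of_nonneg (by positivity)]; linarith)
    calc _ ≤ (t : ℝ≥0∞) * 1 := h3.trans (h1.trans (by gcongr))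
      _ ≤ 0 + ε := by
        rw [mul_one, zero_add]
        exact_mod_cast min_le_left ε 1
  have key2 : ∀ᵐ x, ∀ n : ℕ, A.toFun x ‖((n : ℝ) • f.fn) x‖₊ = 0 := by
    rw [ae_all_iff]
    intro n
    have := (lintegral_eq_zero_iff'
      (A.aemeasurable_modular (f.fn_stronglyMeasurable.const_smul (n : ℝ)))).1 (key n)
    filter_upwards [this] with x hx
    simpa [PhiFunction.toENN] using hx
  apply Subtype.ext
  apply AEEqFun.ext
  have z := AEEqFun.coeFn_zero (α := EuclideanSpace ℝ (Fin d)) (β := F) (μ := volume)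
  filter_upwards [key2, A.ae_monotone, A.ae_tendsto_atTop, z] with x hx hm ht hz
  change f.fn x = (0 : EuclideanSpace ℝ (Fin d) →ₘ[volume] F) x
  rw [hz]
  by_contra hne
  obtain ⟨l, hl⟩ := (ht.eventually_gt_atTop 0).exists
  have hpos : 0 < ‖f.fn x‖₊ := nnnorm_pos.2 hne
  obtain ⟨n, hn⟩ := exists_nat_ge (l / ‖f.fn x‖₊)
  rw [div_le_iff₀ hpos] at hn
  have h1 : l ≤ ‖((n : ℝ) • f.fn) x‖₊ := by
    simpa [nnnorm_smul] using hn
  exact absurd (hx n) (hl.trans_le (hm h1)).ne'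

lemma core : NormedSpace.Core ℝ (OrliczSpace A F) where
  norm_nonneg := norm_nonneg'
  norm_smul c f := by
    refine le_antisymm (norm_smul_le' c f) ?_
    rcases eq_or_ne c 0 with rfl | hc
    · simpa using norm_nonneg' (0 : OrliczSpace A F)
    · have := norm_smul_le' c⁻¹ (c • f)
      rw [smul_smul, inv_mul_cancel₀ hc, one_smul, abs_inv,
        le_inv_mul_iff₀ (abs_pos.2 hc)] at this
      exact this
  norm_triangle := norm_add_le'
  norm_eq_zero_iff f := by
    refine ⟨eq_zero_of_norm f, ?_⟩
    rintro rfl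
    refine le_antisymm ?_ (norm_nonneg' _)
    have := norm_smul_le' 0 (0 : OrliczSpace A F)
    simpa using this

instance : NormedAddCommGroup (OrliczSpace A F) :=
  NormedAddCommGroup.ofCore core

instance : NormedSpace ℝ (OrliczSpace A F) :=
  NormedSpace.ofCore core

end OrliczSpace

end Orlicz

/-! ### The Riesz fractional gradient -/

section Gradient

variable {d : ℕ}

/-- The constant `μ(d,s) = 2^s Γ((d+s+1)/2) / (π^{d/2} Γ((1-s)/2))`. -/
def rieszConst (d : ℕ) (s : ℝ) : ℝ :=
  2 ^ s * Real.Gamma ((d + s + 1) / 2) / (Real.pi ^ ((d : ℝ) / 2) * Real.Gamma ((1 - s) / 2))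

/-- The Riesz potential `I_{1-s} φ` of order `1 - s ∈ (0,1)`; for `s = 1` it is `I_0 φ = φ`. -/
def rieszPotential (s : ℝ) (φ : EuclideanSpace ℝ (Fin d) → ℝ) (x : EuclideanSpace ℝ (Fin d)) : ℝ :=
  if s < 1 then
    rieszConst d s / (d + s - 1) * ∫ y, φ y / ‖x - y‖ ^ ((d : ℝ) + s - 1)
  else φ x

/-- The Riesz fractional gradient `D^s φ = D (I_{1-s} φ)` of a test function. -/
def fracGradient (s : ℝ) (φ : EuclideanSpace ℝ (Fin d) → ℝ) :
    EuclideanSpace ℝ (Fin d) → EuclideanSpace ℝ (Fin d) :=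
  ∇ (rieszPotential s φ)

lemma locallyIntegrable_rieszKernel {s : ℝ} (hs : s < 1) :
    LocallyIntegrable (fun x : EuclideanSpace ℝ (Fin d) => (‖x‖ ^ ((d : ℝ) + s - 1))⁻¹) volume := by
  rcases Nat.eq_zero_or_pos d with rfl | hd
  · exact (continuous_of_discreteTopology).locallyIntegrable
  have : Nonempty (Fin d) := ⟨⟨0, hd⟩⟩
  have hb : ∀ r : ℝ, IntegrableOn
      (fun x : EuclideanSpace ℝ (Fin d) => (‖x‖ ^ ((d : ℝ) + s - 1))⁻¹) (Metric.ball 0 r) := by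
    intro r
    rw [integrableOn_fun_norm_addHaar (μ := volume) (f := fun y : ℝ => (y ^ ((d : ℝ) + s - 1))⁻¹),
      finrank_euclideanSpace, Fintype.card_fin]
    have h1 : IntegrableOn (fun y : ℝ => y ^ (-s)) (Ioo 0 r) := by
      rcases le_or_gt r 0 with hr | hr
      · simp [Ioo_eq_empty_of_le hr]
      · exact (intervalIntegral.integrableOn_Ioo_rpow_iff hr).2 (by linarith)
    refine h1.congr_fun (fun y hy => ?_) measurableSet_Ioo
    have hy0 : 0 < y := hy.1
    simp only [smul_eq_mul]
    rw [← Real.rpow_neg hy0.le, ← Real.rpow_natCast, ← Real.rpow_add hy0, Nat.cast_pred hd]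
    congr 1
    ring
  intro x
  refine ⟨Metric.ball 0 (‖x‖ + 1), Metric.isOpen_ball.mem_nhds ?_, hb _⟩
  simp

lemma rieszPotential_differentiable (s : ℝ) {Ω : TopologicalSpace.Opens (EuclideanSpace ℝ (Fin d))}
    (φ : 𝓓(Ω, ℝ)) : Differentiable ℝ (rieszPotential s φ) := by
  by_cases hs : s < 1
  · have h : rieszPotential s φ = fun x => rieszConst d s / (d + s - 1) *
        convolution φ (fun x => (‖x‖ ^ ((d : ℝ) + s - 1))⁻¹) (ContinuousLinearMap.mul ℝ ℝ)
          volume x := by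
      funext x
      simp [rieszPotential, hs, convolution, div_eq_mul_inv]
    rw [h]
    intro x
    exact ((φ.hasCompactSupport.hasFDerivAt_convolution_left _
      (φ.contDiff.of_le (by simp)) (locallyIntegrable_rieszKernel hs) x).differentiableAt).const_mul _
  · have h : rieszPotential s φ = φ := by
      funext x
      simp [rieszPotential, hs]
    rw [h]
    exact φ.contDiff.differentiable (by simp)

lemma rieszPotential_integrable {s : ℝ} (hs : s < 1)
    {Ω : TopologicalSpace.Opens (EuclideanSpace ℝ (Fin d))}
    (φ : 𝓓(Ω, ℝ)) (x : EuclideanSpace ℝ (Fin d)) :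
    Integrable (fun y => φ y / ‖x - y‖ ^ ((d : ℝ) + s - 1)) volume := by
  have := φ.hasCompactSupport.convolutionExists_left (ContinuousLinearMap.mul ℝ ℝ)
    φ.continuous (locallyIntegrable_rieszKernel (d := d) hs) x
  simpa [ConvolutionExistsAt, div_eq_mul_inv] using this

lemma rieszPotential_add (s : ℝ) {Ω : TopologicalSpace.Opens (EuclideanSpace ℝ (Fin d))}
    (φ ψ : 𝓓(Ω, ℝ)) :
    rieszPotential s (φ + ψ : 𝓓(Ω, ℝ)) = rieszPotential s φ + rieszPotential s ψ := by
  funext x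
  by_cases hs : s < 1
  · simp only [rieszPotential, hs, if_true, Pi.add_apply, ← mul_add]
    rw [← integral_add (rieszPotential_integrable hs φ x) (rieszPotential_integrable hs ψ x)]
    simp [add_div]
  · simp [rieszPotential, hs]

lemma rieszPotential_smul (s c : ℝ) {Ω : TopologicalSpace.Opens (EuclideanSpace ℝ (Fin d))}
    (φ : 𝓓(Ω, ℝ)) :
    rieszPotential s (c • φ : 𝓓(Ω, ℝ)) = c • rieszPotential s φ := by
  funext x
  by_cases hs : s < 1
  · simp only [rieszPotential, hs, if_true, Pi.smul_apply, smul_eq_mul]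
    rw [mul_left_comm, ← integral_const_mul c]
    simp [mul_div_assoc]
  · simp [rieszPotential, hs]

lemma fracGradient_add (s : ℝ) {Ω : TopologicalSpace.Opens (EuclideanSpace ℝ (Fin d))}
    (φ ψ : 𝓓(Ω, ℝ)) :
    fracGradient s (φ + ψ : 𝓓(Ω, ℝ)) = fracGradient s φ + fracGradient s ψ := by
  funext x
  simp only [fracGradient, gradient, rieszPotential_add, Pi.add_apply]
  rw [fderiv_add (rieszPotential_differentiable s φ x) (rieszPotential_differentiable s ψ x),
    map_add]

lemma fracGradient_smul (s c : ℝ) {Ω : TopologicalSpace.Opens (EuclideanSpace ℝ (Fin d))}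
    (φ : 𝓓(Ω, ℝ)) :
    fracGradient s (c • φ : 𝓓(Ω, ℝ)) = c • fracGradient s φ := by
  funext x
  simp only [fracGradient, gradient, rieszPotential_smul, Pi.smul_apply]
  rw [fderiv_const_smul (rieszPotential_differentiable s φ x), map_smul]

end Gradient

/-! ### The fractional Sobolev-Orlicz space and its dual -/

section Sobolev

variable {d : ℕ}

/-- The pairs `(φ, D^s φ)` with `φ ∈ C_c^∞(Ω)`, extended by `0` to `ℝ^d`, for which the norm
`‖φ‖_{L^A(ℝ^d)} + ‖D^s φ‖_{L^A(ℝ^d; ℝ^d)}` is finite, inside `L^A(ℝ^d) × L^A(ℝ^d; ℝ^d)` with the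
sum norm. -/
def testGraph (s : ℝ) (A : PhiFunction d) (Ω : TopologicalSpace.Opens (EuclideanSpace ℝ (Fin d))) :
    Submodule ℝ (WithLp 1 (OrliczSpace A ℝ × OrliczSpace A (EuclideanSpace ℝ (Fin d)))) where
  carrier := {p | ∃ φ : 𝓓(Ω, ℝ), p.fst.fn =ᵐ[volume] φ ∧ p.snd.fn =ᵐ[volume] fracGradient s φ}
  zero_mem' := by
    refine ⟨0, ?_, ?_⟩
    · filter_upwards [OrliczSpace.fn_zero (A := A) (F := ℝ)] with x hx
      simpa using hx
    · have h : fracGradient s (0 : 𝓓(Ω, ℝ)) = 0 := by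
        simpa using fracGradient_smul s 0 (0 : 𝓓(Ω, ℝ))
      rw [h]
      exact OrliczSpace.fn_zero
  add_mem' := by
    rintro p p' ⟨φ, h1, h2⟩ ⟨φ', h1', h2'⟩
    refine ⟨φ + φ', ?_, ?_⟩
    · filter_upwards [OrliczSpace.fn_add p.fst p'.fst, h1, h1'] with x hx e e'
      simp [hx, e, e']
    · rw [fracGradient_add]
      filter_upwards [OrliczSpace.fn_add p.snd p'.snd, h2, h2'] with x hx e e'
      simp [hx, e, e']
  smul_mem' := by
    rintro c p ⟨φ, h1, h2⟩
    refine ⟨c • φ, ?_, ?_⟩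
    · filter_upwards [OrliczSpace.fn_smul c p.fst, h1] with x hx e
      simp [hx, e]
    · rw [fracGradient_smul]
      filter_upwards [OrliczSpace.fn_smul c p.snd, h2] with x hx e
      simp [hx, e]

/-- The space `Λ^{s,A}_0(Ω)`: the completion of the test functions for the norm
`‖u‖_{L^A(ℝ^d)} + ‖D^s u‖_{L^A(ℝ^d; ℝ^d)}`. As `L^A` is complete, it is realized as the closure of
the graph `{(φ, D^s φ)}` in `L^A(ℝ^d) × L^A(ℝ^d; ℝ^d)` with the sum norm. -/
abbrev FracSobolevOrlicz (s : ℝ) (A : PhiFunction d)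
    (Ω : TopologicalSpace.Opens (EuclideanSpace ℝ (Fin d))) : Type :=
  (testGraph s A Ω).topologicalClosure

namespace FracSobolevOrlicz

variable {s : ℝ} {A : PhiFunction d} {Ω : TopologicalSpace.Opens (EuclideanSpace ℝ (Fin d))}

/-- The function in `L^A(ℝ^d)` given by an element of `Λ^{s,A}_0(Ω)`: the limit of `φ_n` for
test functions `φ_n` converging to the element. -/
def toOrlicz (g : FracSobolevOrlicz s A Ω) : OrliczSpace A ℝ :=
  (g : WithLp 1 (OrliczSpace A ℝ × OrliczSpace A (EuclideanSpace ℝ (Fin d)))).fst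

/-- `D^s g` for `g ∈ Λ^{s,A}_0(Ω)`: the limit in `L^A(ℝ^d; ℝ^d)` of `D^s φ_n` for test
functions `φ_n` converging to `g`. -/
def grad (g : FracSobolevOrlicz s A Ω) : OrliczSpace A (EuclideanSpace ℝ (Fin d)) :=
  (g : WithLp 1 (OrliczSpace A ℝ × OrliczSpace A (EuclideanSpace ℝ (Fin d)))).snd

lemma norm_eq (g : FracSobolevOrlicz s A Ω) : ‖g‖ = ‖g.toOrlicz‖ + ‖g.grad‖ :=
  WithLp.prod_norm_eq_of_L1 _

end FracSobolevOrlicz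

/-- The dual `Λ^{-s,A'}(Ω)` of `Λ^{s,A}_0(Ω)`: the continuous linear functionals. -/
abbrev FracSobolevOrliczDual (s : ℝ) (A : PhiFunction d)
    (Ω : TopologicalSpace.Opens (EuclideanSpace ℝ (Fin d))) : Type :=
  StrongDual ℝ (FracSobolevOrlicz s A Ω)

end Sobolev

end

/-!
The representation of the dual of `Λ^{s,A}_0(Ω)` comes from the Riesz representation
`(L^A)* = L^{A'}`, which holds under `(Dec)_q`. The space is a subspace of
`L^A(ℝ^d) × L^A(ℝ^d; ℝ^d)`, so by Hahn-Banach a functional on it is the sum of a functional of `g`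
and a functional of `D^s g`, and each is integration against a function in `L^{A'}`. Elements of
the space vanish a.e. off `Ω` (`FracSobolevOrlicz.ae_eq_zero_of_notMem`), so that the scalar
pairing lives on `Ω`. Nothing about the operator `D^s` beyond linearity enters.

For a functional `G` on scalar `L^A`, `(Dec)_q` gives dominated convergence in the Luxemburg norm
(`OrliczSpace.tendsto_of_dominated`). Simple functions need not belong to `L^A`, so a weight
`w > 0` in `L^A` is fixed (`PhiFunction.exists_pos_memOrlicz`). Then `E ↦ G (w 1_E)` is a signed
measure, absolutely continuous with respect to Lebesgue measure, and its Radon-Nikodym density `g`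
satisfies `G (w t) = ∫ g t` for simple `t` (`exists_density`). Approximation by simple multiples of
`w` and Fatou's lemma extend this to `G u = ∫ (g / w) u` for every `u ∈ L^A`
(`integrable_and_apply_eq_integral`). That `g / w` lies in `L^{A'}` follows by testing `G` with
simple multiples of `w` that nearly attain the supremum in
`A'(x, |g| / w) = sup_t (t |g| - A(x, t w))` (`memOrlicz_conj_density`). The vector-valued case is
treated coordinate by coordinate (`exists_representation_vector`).
-/

noncomputable section

/-! ### Growth and measurability of a `Φ`-function -/

namespace PhiFunction

variable {d : ℕ} {F : Type*} [NormedAddCommGroup F] {A : PhiFunction d}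

/-- `(Dec)_q` yields the doubling property in the form `A(x, K ℓ) ≤ K^q A(x, ℓ)` for `K ≥ 1`. -/
lemma Dec.ae_mul_le {q : ℝ} (hA : A.Dec q) {K : ℝ≥0} (hK : 1 ≤ K) :
    ∀ᵐ x, ∀ l : ℝ≥0, A.toFun x (K * l) ≤ K ^ q * A.toFun x l := by
  filter_upwards [hA, A.ae_zero] with x hx h0 l
  rcases eq_zero_or_pos l with rfl | hl
  · simp [h0]
  have hK0 : 0 < K := one_pos.trans_le hK
  have h := hx (mem_Ioi.2 hl) (mem_Ioi.2 (mul_pos hK0 hl)) (le_mul_of_one_le_left' hK)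
  have hlq : 0 < l ^ q := NNReal.rpow_pos hl
  have hKq : 0 < K ^ q := NNReal.rpow_pos hK0
  simp only [NNReal.mul_rpow] at h
  rw [div_le_div_iff₀ (by positivity) hlq] at h
  have h' : A.toFun x (K * l) * l ^ q ≤ (K ^ q * A.toFun x l) * l ^ q := by
    calc _ ≤ _ := h
      _ = _ := by ring
  exact le_of_mul_le_mul_right h' hlq

lemma aemeasurable_toENN {f : EuclideanSpace ℝ (Fin d) → F} (hf : AEStronglyMeasurable f volume) :
    AEMeasurable (fun x => A.toENN x ‖f x‖₊) volume := by
  refine (A.aemeasurable_modular hf.stronglyMeasurable_mk).congr ?_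
  filter_upwards [hf.ae_eq_mk] with x hx
  rw [hx]

variable [NormedSpace ℝ F]

/-- Under `(Dec)_q` the modular of every multiple of `f` is finite as soon as one is. -/
lemma Dec.modular_smul_lt_top {q : ℝ} (hA : A.Dec q) {f : EuclideanSpace ℝ (Fin d) → F}
    (hf : MemOrlicz A.toENN f volume) (c : ℝ) :
    orliczModular A.toENN (c • f) volume < ∞ := by
  obtain ⟨-, ρ, hρ, hfin⟩ := hf
  set K : ℝ≥0 := 1 + ‖c‖₊ / ‖ρ‖₊ with hKdef
  have hρ0 : ‖ρ‖₊ ≠ 0 := by simpa using hρ.ne'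
  have hc : ‖c‖₊ ≤ K * ‖ρ‖₊ := by
    rw [hKdef, add_mul, div_mul_cancel₀ _ hρ0]
    exact le_add_self
  calc orliczModular A.toENN (c • f) volume
      ≤ ∫⁻ x, (K ^ q : ℝ≥0) * A.toENN x ‖(ρ • f) x‖₊ := by
        refine lintegral_mono_ae ?_
        filter_upwards [hA.ae_mul_le (K := K) (by simp [hKdef]), A.ae_monotone] with x hx hm
        refine le_trans (ENNReal.coe_le_coe.2 (hm ?_)) (by
          unfold toENN
          exact_mod_cast hx ‖(ρ • f) x‖₊)
        simp only [Pi.smul_apply, nnnorm_smul, ← mul_assoc]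
        gcongr
    _ = (K ^ q : ℝ≥0) * orliczModular A.toENN (ρ • f) volume :=
        lintegral_const_mul' _ _ ENNReal.coe_ne_top
    _ < ∞ := ENNReal.mul_lt_top ENNReal.coe_lt_top hfin

/-- The class `L^A` is solid: it contains every measurable function dominated by a member. -/
lemma memOrlicz_of_le {G : Type*} [NormedAddCommGroup G] [NormedSpace ℝ G]
    {f : EuclideanSpace ℝ (Fin d) → F} {g : EuclideanSpace ℝ (Fin d) → G}
    (hg : MemOrlicz A.toENN g volume)
    (hf : AEStronglyMeasurable f volume) (h : ∀ᵐ x, ‖f x‖ ≤ ‖g x‖) :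
    MemOrlicz A.toENN f volume := by
  obtain ⟨-, ρ, hρ, hfin⟩ := hg
  refine ⟨hf, ρ, hρ, lt_of_le_of_lt (lintegral_mono_ae ?_) hfin⟩
  filter_upwards [h, A.ae_monotone] with x hx hm
  refine ENNReal.coe_le_coe.2 (hm ?_)
  simp only [Pi.smul_apply, nnnorm_smul]
  gcongr
  exact hx

/-- There is a strictly positive weight in `L^A(ℝ^d)`. By convexity `A(x, w) ≤ w A(x, 1)` for
`w ≤ 1`, so a positive integrable function divided by `1 + A(x, 1)` has this property. -/
lemma exists_pos_memOrlicz (A : PhiFunction d) :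
    ∃ w : EuclideanSpace ℝ (Fin d) → ℝ, Measurable w ∧ (∀ x, 0 < w x) ∧
      MemOrlicz A.toENN w volume := by
  obtain ⟨η, hη0, hηm, hη⟩ := exists_pos_lintegral_lt_of_sigmaFinite
    (volume : Measure (EuclideanSpace ℝ (Fin d))) one_ne_zero
  have ha := A.aemeasurable_comp (fun _ => 1) measurable_const
  set a := ha.mk with ha_def
  set w : EuclideanSpace ℝ (Fin d) → ℝ≥0 := fun x => min 1 (η x / (1 + a x)) with hw
  have hwm : Measurable w :=
    measurable_const.min (hηm.div (measurable_const.add ha.measurable_mk))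
  refine ⟨fun x => w x, hwm.coe_nnreal_real, fun x => ?_,
    hwm.coe_nnreal_real.aestronglyMeasurable, 1, one_pos, ?_⟩
  · have := hη0 x
    simp only [hw, NNReal.coe_pos]
    positivity
  · refine lt_of_le_of_lt (lintegral_mono_ae ?_) (hη.trans ENNReal.one_lt_top)
    filter_upwards [ha.ae_eq_mk, A.ae_zero, A.ae_convexOn] with x hx h0 hc
    have h1 : w x ≤ 1 := min_le_left _ _
    have h2 := hc.2 (mem_univ (1 : ℝ≥0)) (mem_univ (0 : ℝ≥0)) zero_le zero_le
      (add_tsub_cancel_of_le h1)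
    simp only [smul_eq_mul, mul_one, mul_zero, add_zero, h0] at h2
    have h3 : w x * A.toFun x 1 ≤ η x := by
      rw [hx]
      calc w x * a x ≤ η x / (1 + a x) * (1 + a x) := by
            gcongr
            · exact min_le_right _ _
            · exact le_add_self
        _ = η x := div_mul_cancel₀ _ (by positivity)
    have h4 : ‖((1 : ℝ) • fun x => (w x : ℝ)) x‖₊ = w x := by simp
    rw [h4]
    exact ENNReal.coe_le_coe.2 (h2.trans h3)

end PhiFunction

/-! ### Order and convergence in `L^A` -/

namespace OrliczSpace

variable {d : ℕ} {F : Type*} [NormedAddCommGroup F] [NormedSpace ℝ F] {A : PhiFunction d}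

/-- The element of `L^A(ℝ^d; F)` represented by a function. -/
def ofFun (f : EuclideanSpace ℝ (Fin d) → F) (hf : MemOrlicz A.toENN f volume) :
    OrliczSpace A F :=
  ⟨AEEqFun.mk f hf.1, AEEqFun.aestronglyMeasurable _, by
    obtain ⟨-, ρ, hρ, h⟩ := hf
    refine ⟨ρ, hρ, ?_⟩
    rwa [orliczModular_congr ((AEEqFun.coeFn_mk f _).const_smul ρ)]⟩

lemma fn_ofFun {f : EuclideanSpace ℝ (Fin d) → F} (hf : MemOrlicz A.toENN f volume) :
    (ofFun f hf).fn =ᵐ[volume] f :=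
  AEEqFun.coeFn_mk f _

lemma fn_memOrlicz (f : OrliczSpace A F) : MemOrlicz A.toENN f.fn volume := f.2

lemma ext_fn {f g : OrliczSpace A F} (h : f.fn =ᵐ[volume] g.fn) : f = g :=
  Subtype.ext (AEEqFun.ext h)

lemma fn_sub (f g : OrliczSpace A F) : (f - g).fn =ᵐ[volume] f.fn - g.fn :=
  AEEqFun.coeFn_sub _ _

lemma norm_le_norm_of_ae_le {G : Type*} [NormedAddCommGroup G] [NormedSpace ℝ G]
    {f : OrliczSpace A F} {g : OrliczSpace A G}
    (h : ∀ᵐ x, ‖f.fn x‖ ≤ ‖g.fn x‖) : ‖f‖ ≤ ‖g‖ := by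
  refine le_of_forall_gt_imp_ge_of_dense fun ρ hρ => ?_
  have hρ0 : 0 < ρ := g.norm_nonneg'.trans_lt hρ
  refine norm_le_of_modular hρ0 (le_trans (lintegral_mono_ae ?_) (modular_le_one hρ))
  filter_upwards [h, A.ae_monotone] with x hx hm
  refine ENNReal.coe_le_coe.2 (hm ?_)
  simp only [Pi.smul_apply, nnnorm_smul]
  gcongr
  exact hx

lemma norm_le_one_add_modular (f : OrliczSpace A F)
    (h : orliczModular A.toENN f.fn volume ≠ ∞) :
    ‖f‖ ≤ 1 + (orliczModular A.toENN f.fn volume).toReal := by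
  lift orliczModular A.toENN f.fn volume to ℝ≥0 using h with M hM
  have hM0 : (0 : ℝ≥0) < 1 + M := by positivity
  refine norm_le_of_modular (by simpa using add_pos_of_pos_of_nonneg one_pos M.2) ?_
  have h1 := A.modular_smul_le f.fn_stronglyMeasurable (t := (1 + M)⁻¹)
    (inv_le_one_of_one_le₀ (by simp))
  rw [← hM] at h1
  refine le_trans (b := (((1 + M)⁻¹ * M : ℝ≥0) : ℝ≥0∞)) (by simpa [ENNReal.coe_mul] using h1) ?_
  norm_cast
  rw [inv_mul_le_iff₀ hM0]
  simp

/-- Dominated convergence in `L^A` under `(Dec)_q`. -/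
lemma tendsto_of_dominated {q : ℝ} (hA : A.Dec q) {ι : Type*} {l : Filter ι}
    [l.IsCountablyGenerated] {u : ι → OrliczSpace A F} {v : OrliczSpace A F}
    (b : OrliczSpace A ℝ) (hb : ∀ i, ∀ᵐ x, ‖(u i).fn x‖ ≤ ‖b.fn x‖)
    (hlim : ∀ᵐ x, Tendsto (fun i => (u i).fn x) l (𝓝 (v.fn x))) :
    Tendsto u l (𝓝 v) := by
  refine tendsto_of_seq_tendsto fun k hk => ?_
  have hlim' : ∀ᵐ x, Tendsto (fun n => (u (k n)).fn x) atTop (𝓝 (v.fn x)) :=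
    hlim.mono fun x hx => hx.comp hk
  have hv : ∀ᵐ x, ‖v.fn x‖ ≤ ‖b.fn x‖ := by
    filter_upwards [hlim', ae_all_iff.2 fun n => hb (k n)] with x hx hbx
    exact le_of_tendsto hx.norm (Eventually.of_forall hbx)
  rw [tendsto_iff_norm_sub_tendsto_zero, Metric.tendsto_atTop]
  intro ε hε
  have key : Tendsto (fun n => orliczModular A.toENN ((ε / 2)⁻¹ • ((u (k n)).fn - v.fn)) volume)
      atTop (𝓝 (∫⁻ _ : EuclideanSpace ℝ (Fin d), 0)) := by
    refine tendsto_lintegral_of_dominated_convergence'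
      (fun x => A.toENN x ‖(((ε / 2)⁻¹ * 2) • b.fn) x‖₊) (fun n => ?_) (fun n => ?_) ?_ ?_
    · exact A.aemeasurable_toENN ((((u (k n)).fn_stronglyMeasurable.sub
        v.fn_stronglyMeasurable).const_smul _).aestronglyMeasurable)
    · filter_upwards [hb (k n), hv, A.ae_monotone] with x h1 h2 hm
      refine ENNReal.coe_le_coe.2 (hm ?_)
      rw [← NNReal.coe_le_coe]
      simp only [Pi.smul_apply, Pi.sub_apply, coe_nnnorm, norm_smul, norm_mul, mul_assoc]
      gcongr
      refine (norm_sub_le _ _).trans ?_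
      simp only [Real.norm_ofNat] at *
      linarith
    · exact (hA.modular_smul_lt_top b.fn_memOrlicz _).ne
    · filter_upwards [hlim', A.ae_tendsto_zero, A.ae_zero] with x hx ht h0
      have h1 : Tendsto (A.toFun x) (𝓝 0) (𝓝 0) := by
        have : ContinuousWithinAt (A.toFun x) (Ioi 0) 0 := by
          simpa [ContinuousWithinAt, h0] using ht
        have h2 : ContinuousWithinAt (A.toFun x) univ 0 := by
          have := continuousWithinAt_insert_self.2 this
          rwa [show insert (0 : ℝ≥0) (Ioi 0) = univ by
            ext y; simp] at this
        simpa [ContinuousWithinAt, h0] using h2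
      have h2 : Tendsto (fun n => ‖((ε / 2)⁻¹ • ((u (k n)).fn - v.fn)) x‖₊) atTop (𝓝 0) := by
        have : Tendsto (fun n => (ε / 2)⁻¹ • ((u (k n)).fn x - v.fn x)) atTop (𝓝 0) := by
          simpa using (hx.sub_const (v.fn x)).const_smul (ε / 2)⁻¹
        simpa using this.nnnorm
      simpa [PhiFunction.toENN] using ENNReal.tendsto_coe.2 (h1.comp h2)
  rw [lintegral_zero] at key
  obtain ⟨N, hN⟩ := eventually_atTop.1 (key.eventually_le_const (zero_lt_one' ℝ≥0∞))
  refine ⟨N, fun n hn => ?_⟩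
  have h1 : ‖u (k n) - v‖ ≤ ε / 2 := by
    refine norm_le_of_modular (by positivity) ?_
    rw [orliczModular_congr ((fn_sub _ _).const_smul _)]
    exact hN n hn
  rw [Real.dist_eq, sub_zero, abs_of_nonneg (norm_nonneg _)]
  exact h1.trans_lt (half_lt_self hε)

end OrliczSpace

/-! ### Functionals on scalar `L^A` -/

section Scalar

variable {d : ℕ} {A : PhiFunction d} {w : EuclideanSpace ℝ (Fin d) → ℝ}

lemma memOrlicz_simpleFunc_mul (hw : MemOrlicz A.toENN w volume)
    (t : SimpleFunc (EuclideanSpace ℝ (Fin d)) ℝ) :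
    MemOrlicz A.toENN (fun x => t x * w x) volume := by
  obtain ⟨C, hC⟩ := t.exists_forall_norm_le
  refine PhiFunction.memOrlicz_of_le (C • OrliczSpace.ofFun w hw).fn_memOrlicz
    (t.aestronglyMeasurable.mul hw.1) ?_
  filter_upwards [OrliczSpace.fn_smul C (OrliczSpace.ofFun w hw), OrliczSpace.fn_ofFun hw]
    with x h1 h2
  rw [h1, Pi.smul_apply, h2, norm_mul, norm_smul]
  gcongr
  exact (hC x).trans (le_abs_self C)

/-- Multiplication of simple functions by a weight in `L^A`, as a map into `L^A`. -/
def simpleMul (hw : MemOrlicz A.toENN w volume) :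
    SimpleFunc (EuclideanSpace ℝ (Fin d)) ℝ →ₗ[ℝ] OrliczSpace A ℝ where
  toFun t := OrliczSpace.ofFun _ (memOrlicz_simpleFunc_mul hw t)
  map_add' t t' := by
    refine OrliczSpace.ext_fn ?_
    filter_upwards [OrliczSpace.fn_add (OrliczSpace.ofFun _ (memOrlicz_simpleFunc_mul hw t))
      (OrliczSpace.ofFun _ (memOrlicz_simpleFunc_mul hw t')),
      OrliczSpace.fn_ofFun (memOrlicz_simpleFunc_mul hw t),
      OrliczSpace.fn_ofFun (memOrlicz_simpleFunc_mul hw t'),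
      OrliczSpace.fn_ofFun (memOrlicz_simpleFunc_mul hw (t + t'))] with x h1 h2 h3 h4
    rw [h4, h1, Pi.add_apply, h2, h3, SimpleFunc.coe_add, Pi.add_apply, add_mul]
  map_smul' c t := by
    refine OrliczSpace.ext_fn ?_
    filter_upwards [OrliczSpace.fn_smul c (OrliczSpace.ofFun _ (memOrlicz_simpleFunc_mul hw t)),
      OrliczSpace.fn_ofFun (memOrlicz_simpleFunc_mul hw t),
      OrliczSpace.fn_ofFun (memOrlicz_simpleFunc_mul hw (c • t))] with x h1 h2 h3
    rw [h3, RingHom.id_apply, h1, Pi.smul_apply, h2, SimpleFunc.coe_smul, Pi.smul_apply,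
      smul_eq_mul, smul_eq_mul, mul_assoc]

lemma fn_simpleMul (hw : MemOrlicz A.toENN w volume)
    (t : SimpleFunc (EuclideanSpace ℝ (Fin d)) ℝ) :
    (simpleMul hw t).fn =ᵐ[volume] fun x => t x * w x :=
  OrliczSpace.fn_ofFun (memOrlicz_simpleFunc_mul hw t)

/-- A continuous functional `G` on `L^A` is, on products of simple functions with the weight `w`,
integration against an integrable density. Indeed `E ↦ G (w 1_E)` is a signed measure, countable
additivity being dominated convergence in `L^A`, and it vanishes on null sets. -/
lemma exists_density {q : ℝ} (hA : A.Dec q) (hw : MemOrlicz A.toENN w volume)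
    (G : StrongDual ℝ (OrliczSpace A ℝ)) :
    ∃ g : EuclideanSpace ℝ (Fin d) → ℝ, Measurable g ∧ Integrable g volume ∧
      ∀ t : SimpleFunc (EuclideanSpace ℝ (Fin d)) ℝ, G (simpleMul hw t) = ∫ x, g x * t x := by
  let χ : Set (EuclideanSpace ℝ (Fin d)) → SimpleFunc (EuclideanSpace ℝ (Fin d)) ℝ :=
    fun E => (SimpleFunc.const _ 1).restrict E
  have hχ : ∀ {E}, MeasurableSet E → ⇑(χ E) = E.indicator 1 := fun hE => by
    ext x
    simp [χ, SimpleFunc.restrict_apply _ hE, indicator]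
  let ν : SignedMeasure (EuclideanSpace ℝ (Fin d)) :=
    { measureOf' := fun E => G (simpleMul hw (χ E))
      empty' := by simp [χ]
      not_measurable' := fun E hE => by simp [χ, SimpleFunc.restrict_of_not_measurable hE]
      m_iUnion' := fun E hE hd => by
        have key : HasSum (fun i => simpleMul hw (χ (E i))) (simpleMul hw (χ (⋃ i, E i))) := by
          have hsum : ∀ s : Finset ℕ, ∑ i ∈ s, simpleMul hw (χ (E i)) =
              simpleMul hw (χ (⋃ i ∈ s, E i)) := fun s => by
            rw [← map_sum]
            congr 1
            ext x
            have hc : (∑ i ∈ s, χ (E i)) x = ∑ i ∈ s, χ (E i) x := by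
              classical
              induction s using Finset.induction_on with
              | empty => simp
              | insert i s hi ih =>
                rw [Finset.sum_insert hi, Finset.sum_insert hi, SimpleFunc.coe_add, Pi.add_apply,
                  ih]
            rw [hc, hχ (s.measurableSet_biUnion fun i _ => hE i),
              Finset.indicator_biUnion s E (fun i _ j _ hij => hd hij)]
            exact Finset.sum_congr rfl fun i _ => by rw [hχ (hE i)]
          unfold HasSum
          simp only [hsum]
          refine OrliczSpace.tendsto_of_dominated hA (OrliczSpace.ofFun w hw) (fun s => ?_) ?_
          · filter_upwards [fn_simpleMul hw (χ (⋃ i ∈ s, E i)), OrliczSpace.fn_ofFun hw]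
              with x h1 h2
            rw [h1, h2, hχ (s.measurableSet_biUnion fun i _ => hE i), norm_mul]
            refine mul_le_of_le_one_left (norm_nonneg _) ?_
            by_cases hx : x ∈ ⋃ i ∈ s, E i <;> simp only [indicator, hx] <;> simp
          · filter_upwards [ae_all_iff.2 fun s : Finset ℕ => fn_simpleMul hw (χ (⋃ i ∈ s, E i)),
              fn_simpleMul hw (χ (⋃ i, E i))] with x h1 h2
            simp only [h1, h2]
            refine Tendsto.mul_const _ ?_
            rw [hχ (MeasurableSet.iUnion hE)]
            refine Tendsto.congr (fun s => ?_)
              ((tendsto_indicator_biUnion_finset E 1 x).mono_right (pure_le_nhds _))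
            rw [hχ (s.measurableSet_biUnion fun i _ => hE i)]
        exact key.mapL G }
  have hν : ∀ E, ν E = G (simpleMul hw (χ E)) := fun E => rfl
  have hac : ν ≪ᵥ (volume : Measure (EuclideanSpace ℝ (Fin d))).toENNRealVectorMeasure := by
    refine VectorMeasure.AbsolutelyContinuous.mk fun E hE h0 => ?_
    rw [Measure.toENNRealVectorMeasure_apply_measurable hE] at h0
    have : simpleMul hw (χ E) = 0 := by
      refine OrliczSpace.ext_fn ?_
      filter_upwards [fn_simpleMul hw (χ E), OrliczSpace.fn_zero (A := A) (F := ℝ),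
        measure_eq_zero_iff_ae_notMem.1 h0] with x h1 h2 h3
      rw [h1, h2, hχ hE]
      simp [h3]
    rw [hν, this, map_zero]
  have hint := ν.integrable_rnDeriv volume
  refine ⟨ν.rnDeriv volume, ν.measurable_rnDeriv volume, hint, fun t => ?_⟩
  have hbase : ∀ E, MeasurableSet E → G (simpleMul hw (χ E)) = ∫ x in E, ν.rnDeriv volume x := by
    intro E hE
    rw [← withDensityᵥ_apply hint hE, ν.withDensityᵥ_rnDeriv_eq volume hac, hν]
  induction t using SimpleFunc.induction with
  | const c hs =>
    rename_i E
    have h1 : SimpleFunc.piecewise E hs (SimpleFunc.const _ c) (SimpleFunc.const _ 0) = c • χ E := by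
      ext x
      rw [SimpleFunc.coe_smul, Pi.smul_apply, hχ hs]
      by_cases hx : x ∈ E <;> simp [hx]
    rw [h1, map_smul, map_smul, hbase E hs, ← integral_indicator hs, smul_eq_mul,
      ← integral_const_mul]
    refine integral_congr_ae (Eventually.of_forall fun x => ?_)
    simp only [SimpleFunc.coe_smul, Pi.smul_apply, hχ hs]
    by_cases hx : x ∈ E <;> simp [hx, mul_comm]
  | add _hd h h' =>
    rename_i t t'
    obtain ⟨C, hC⟩ := t.exists_forall_norm_le
    obtain ⟨C', hC'⟩ := t'.exists_forall_norm_le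
    rw [map_add, map_add, h, h', ← integral_add]
    · simp [mul_add]
    · exact hint.mul_bdd (c := C) t.aestronglyMeasurable (Eventually.of_forall hC)
    · exact hint.mul_bdd (c := C') t'.aestronglyMeasurable (Eventually.of_forall hC')

/-- The sign trick: replacing a simple function `t` by `sign(g) |t|` bounds `∫ |g| |t|`. -/
lemma lintegral_density_mul_le (hw : MemOrlicz A.toENN w volume)
    {G : StrongDual ℝ (OrliczSpace A ℝ)} {g : EuclideanSpace ℝ (Fin d) → ℝ} (hgm : Measurable g)
    (hg : Integrable g volume)
    (hG : ∀ t : SimpleFunc (EuclideanSpace ℝ (Fin d)) ℝ, G (simpleMul hw t) = ∫ x, g x * t x)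
    (t : SimpleFunc (EuclideanSpace ℝ (Fin d)) ℝ) :
    ∫⁻ x, ENNReal.ofReal |g x * t x| ≤ ENNReal.ofReal (‖G‖ * ‖simpleMul hw t‖) := by
  have hs : MeasurableSet {x | 0 ≤ g x} := measurableSet_le measurable_const hgm
  set t' : SimpleFunc (EuclideanSpace ℝ (Fin d)) ℝ :=
    SimpleFunc.piecewise _ hs (t.map fun r => |r|) (t.map fun r => -|r|) with ht'
  have h1 : ∀ x, g x * t' x = |g x * t x| := fun x => by
    rw [ht', SimpleFunc.piecewise_apply, abs_mul]
    by_cases hx : 0 ≤ g x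
    · simp [hx, abs_of_nonneg hx]
    · simp [hx, abs_of_neg (not_le.1 hx)]
  obtain ⟨C, hC⟩ := t.exists_forall_norm_le
  have hint : Integrable (fun x => g x * t x) volume :=
    hg.mul_bdd (c := C) t.aestronglyMeasurable (Eventually.of_forall hC)
  rw [← ofReal_integral_eq_lintegral_ofReal hint.abs (Eventually.of_forall fun x => abs_nonneg _)]
  refine ENNReal.ofReal_le_ofReal ?_
  simp only [← h1, ← hG]
  refine (le_abs_self _).trans ((G.le_opNorm _).trans ?_)
  gcongr
  refine OrliczSpace.norm_le_norm_of_ae_le ?_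
  filter_upwards [fn_simpleMul hw t, fn_simpleMul hw t'] with x h2 h3
  rw [h2, h3, norm_mul, norm_mul, ht', SimpleFunc.piecewise_apply]
  by_cases hx : 0 ≤ g x <;> simp [hx]

/-- The density, divided by the weight, represents the functional on all of `L^A`: bounded
simple multiples of `w` approximate every function, and Fatou's lemma gives the integrability. -/
lemma integrable_and_apply_eq_integral {q : ℝ} (hA : A.Dec q) (hwm : Measurable w)
    (hw0 : ∀ x, 0 < w x) (hw : MemOrlicz A.toENN w volume)
    {G : StrongDual ℝ (OrliczSpace A ℝ)} {g : EuclideanSpace ℝ (Fin d) → ℝ} (hgm : Measurable g)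
    (hg : Integrable g volume)
    (hG : ∀ t : SimpleFunc (EuclideanSpace ℝ (Fin d)) ℝ, G (simpleMul hw t) = ∫ x, g x * t x)
    (u : OrliczSpace A ℝ) :
    Integrable (fun x => g x / w x * u.fn x) volume ∧ G u = ∫ x, g x / w x * u.fn x := by
  set h : EuclideanSpace ℝ (Fin d) → ℝ := fun x => u.fn x / w x with hh
  have hhm : Measurable h := u.fn_stronglyMeasurable.measurable.div hwm
  have hfu : (fun x => g x / w x * u.fn x) = fun x => g x * h x := by
    ext x
    simp only [hh]
    ring
  rw [hfu]
  let t : ℕ → SimpleFunc (EuclideanSpace ℝ (Fin d)) ℝ :=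
    fun n => SimpleFunc.approxOn h hhm univ 0 (mem_univ _) n
  have htb : ∀ n x, ‖t n x‖ ≤ 2 * ‖h x‖ := fun n x => by
    rw [two_mul]
    exact SimpleFunc.norm_approxOn_zero_le hhm (mem_univ _) x n
  have htl : ∀ x, Tendsto (fun n => t n x) atTop (𝓝 (h x)) := fun x =>
    SimpleFunc.tendsto_approxOn hhm (mem_univ _) (by simp)
  have hwh : ∀ x, h x * w x = u.fn x := fun x => div_mul_cancel₀ _ (hw0 x).ne'
  have hb : ∀ n, ∀ᵐ x, ‖(simpleMul hw (t n)).fn x‖ ≤ ‖((2 : ℝ) • u).fn x‖ := fun n => by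
    filter_upwards [fn_simpleMul hw (t n), OrliczSpace.fn_smul (2 : ℝ) u] with x h1 h2
    rw [h1, h2, Pi.smul_apply, norm_smul, ← hwh, norm_mul, norm_mul, ← mul_assoc]
    simp only [Real.norm_ofNat]
    gcongr
    exact htb n x
  have hlim : Tendsto (fun n => simpleMul hw (t n)) atTop (𝓝 u) := by
    refine OrliczSpace.tendsto_of_dominated hA ((2 : ℝ) • u) hb ?_
    filter_upwards [ae_all_iff.2 fun n => fn_simpleMul hw (t n)] with x h1
    simp only [h1]
    rw [← hwh x]
    exact (htl x).mul_const _
  have hint : Integrable (fun x => g x * h x) volume := by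
    refine ⟨(hgm.mul hhm).aestronglyMeasurable, ?_⟩
    rw [hasFiniteIntegral_iff_norm]
    have h1 : ∀ x, Tendsto (fun n => ENNReal.ofReal |g x * t n x|) atTop
        (𝓝 (ENNReal.ofReal ‖g x * h x‖)) := fun x =>
      (ENNReal.continuous_ofReal.tendsto _).comp ((htl x).const_mul (g x)).abs
    calc ∫⁻ x, ENNReal.ofReal ‖g x * h x‖
        = ∫⁻ x, liminf (fun n => ENNReal.ofReal |g x * t n x|) atTop := by
          simp only [(h1 _).liminf_eq]
      _ ≤ liminf (fun n => ∫⁻ x, ENNReal.ofReal |g x * t n x|) atTop :=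
          lintegral_liminf_le fun n => (hgm.mul (t n).measurable).abs.ennreal_ofReal
      _ ≤ ENNReal.ofReal (‖G‖ * ‖(2 : ℝ) • u‖) := by
          refine liminf_le_of_le (by isBoundedDefault) fun b hb' => ?_
          obtain ⟨n, hn⟩ := hb'.exists
          refine hn.trans ((lintegral_density_mul_le hw hgm hg hG (t n)).trans ?_)
          gcongr
          exact OrliczSpace.norm_le_norm_of_ae_le (hb n)
      _ < ∞ := ENNReal.ofReal_lt_top
  refine ⟨hint, tendsto_nhds_unique ((G.continuous.tendsto u).comp hlim) ?_⟩
  simp only [Function.comp_def, hG]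
  refine tendsto_integral_of_dominated_convergence (fun x => 2 * ‖g x * h x‖)
    (fun n => (hgm.mul (t n).measurable).aestronglyMeasurable) (hint.norm.const_mul 2)
    (fun n => Eventually.of_forall fun x => ?_)
    (Eventually.of_forall fun x => (htl x).const_mul _)
  rw [norm_mul, norm_mul]
  nlinarith [htb n x, norm_nonneg (g x)]

end Scalar

/-! ### Membership in the conjugate class -/

section Conjugate

variable {d : ℕ} {A : PhiFunction d}

namespace PhiFunction

/-- Since `A(x, ·)` is monotone, the supremum defining `A'(x, ℓ)` may be taken over a dense
sequence, and over its multiples by a fixed positive number. -/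
lemma conj_eq_iSup {x : EuclideanSpace ℝ (Fin d)} (hm : Monotone (A.toFun x)) {w : ℝ≥0}
    (hw : w ≠ 0) {y : ℕ → ℝ≥0} (hy : DenseRange y) (l : ℝ≥0) :
    A.conj x l = ⨆ n, ENNReal.ofReal ((y n * w : ℝ≥0) * l - A.toFun x (y n * w)) := by
  refine le_antisymm (iSup_le fun r => ?_) (iSup_le fun n => ?_)
  · rcases eq_or_ne r 0 with rfl | hr
    · rw [ENNReal.ofReal_of_nonpos (by simp)]
      exact zero_le
    set S := ⨆ n, ENNReal.ofReal ((y n * w : ℝ≥0) * l - A.toFun x (y n * w)) with hS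
    -- By monotonicity of `A(x, ·)` it suffices to approximate `r` from below in the linear term.
    have hcl : IsClosed {a : ℝ≥0 | ENNReal.ofReal ((a * w : ℝ≥0) * l - A.toFun x r) ≤ S} := by
      refine isClosed_le (ENNReal.continuous_ofReal.comp ?_) continuous_const
      fun_prop
    have hsub : Iio (r / w) ∩ range y ⊆
        {a : ℝ≥0 | ENNReal.ofReal ((a * w : ℝ≥0) * l - A.toFun x r) ≤ S} := by
      rintro _ ⟨ha, n, rfl⟩
      refine le_trans (ENNReal.ofReal_le_ofReal ?_) (le_iSup (fun n => ENNReal.ofReal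
        ((y n * w : ℝ≥0) * l - A.toFun x (y n * w))) n)
      have : A.toFun x (y n * w) ≤ A.toFun x r :=
        hm ((lt_div_iff₀ (pos_of_ne_zero hw)).1 ha).le
      have := NNReal.coe_le_coe.2 this
      linarith
    have hmem : r / w ∈ closure (Iio (r / w) ∩ range y) := by
      refine closure_minimal (hy.open_subset_closure_inter isOpen_Iio) isClosed_closure ?_
      rw [closure_Iio' ⟨0, div_pos (pos_of_ne_zero hr) (pos_of_ne_zero hw)⟩]
      exact self_mem_Iic
    have := closure_minimal hsub hcl hmem
    rwa [mem_ofPred_eq, div_mul_cancel₀ _ hw] at this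
  · exact le_iSup (fun r : ℝ≥0 => ENNReal.ofReal ((r : ℝ) * l - A.toFun x r)) (y n * w)

lemma conj_mono (A : PhiFunction d) (x : EuclideanSpace ℝ (Fin d)) : Monotone (A.conj x) := by
  intro l l' h
  refine iSup_mono fun r => ENNReal.ofReal_le_ofReal ?_
  gcongr

lemma conj_zero (A : PhiFunction d) (x : EuclideanSpace ℝ (Fin d)) : A.conj x 0 = 0 := by
  simp [conj, ENNReal.ofReal_of_nonpos]

lemma aemeasurable_conj {F : Type*} [NormedAddCommGroup F] {f : EuclideanSpace ℝ (Fin d) → F}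
    (hf : AEStronglyMeasurable f volume) : AEMeasurable (fun x => A.conj x ‖f x‖₊) volume := by
  have hy := TopologicalSpace.denseRange_denseSeq ℝ≥0
  set y := TopologicalSpace.denseSeq ℝ≥0
  have h : AEMeasurable (fun x => ⨆ n, ENNReal.ofReal
      ((y n * 1 : ℝ≥0) * (‖f x‖₊ : ℝ) - A.toFun x (y n * 1))) volume :=
    .iSup fun n => ((hf.nnnorm.aemeasurable.coe_nnreal_real.const_mul _).sub
      (A.aemeasurable_comp _ measurable_const).coe_nnreal_real).ennreal_ofReal
  refine h.congr ?_
  filter_upwards [A.ae_monotone] with x hm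
  rw [conj_eq_iSup hm one_ne_zero hy]

end PhiFunction

namespace MemOrlicz

variable {F : Type*} [NormedAddCommGroup F] [NormedSpace ℝ F]

lemma conj_add {f g : EuclideanSpace ℝ (Fin d) → F} (hf : MemOrlicz A.conj f volume)
    (hg : MemOrlicz A.conj g volume) : MemOrlicz A.conj (f + g) volume := by
  obtain ⟨hfm, a, ha, hfa⟩ := hf
  obtain ⟨hgm, b, hb, hgb⟩ := hg
  refine ⟨hfm.add hgm, min a b / 2, by positivity, ?_⟩
  have hle : orliczModular A.conj ((min a b / 2) • (f + g)) volume ≤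
      ∫⁻ x, A.conj x ‖(a • f) x‖₊ + A.conj x ‖(b • g) x‖₊ := by
    refine lintegral_mono fun x => ?_
    -- The mean of two numbers is at most their maximum, so monotonicity of `A'` suffices.
    have h1 : ‖((min a b / 2) • (f + g)) x‖₊ ≤ max ‖(a • f) x‖₊ ‖(b • g) x‖₊ := by
      rw [← NNReal.coe_le_coe, NNReal.coe_max]
      simp only [Pi.smul_apply, Pi.add_apply, coe_nnnorm, norm_smul, Real.norm_eq_abs,
        abs_of_pos ha, abs_of_pos hb, abs_of_pos (show 0 < min a b / 2 by positivity)]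
      have h2 : min a b * ‖f x‖ ≤ a * ‖f x‖ := by gcongr; exact min_le_left _ _
      have h3 : min a b * ‖g x‖ ≤ b * ‖g x‖ := by gcongr; exact min_le_right _ _
      have h4 : min a b / 2 * ‖f x + g x‖ ≤ min a b / 2 * (‖f x‖ + ‖g x‖) := by
        gcongr
        exact norm_add_le _ _
      linarith [le_max_left (a * ‖f x‖) (b * ‖g x‖), le_max_right (a * ‖f x‖) (b * ‖g x‖)]
    refine (A.conj_mono x h1).trans ?_
    rw [(A.conj_mono x).map_max]
    exact max_le_add_of_nonneg zero_le zero_le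
  refine hle.trans_lt ?_
  rw [lintegral_add_left' (A.aemeasurable_conj (hfm.const_smul a))]
  exact ENNReal.add_lt_top.2 ⟨hfa, hgb⟩

lemma conj_zero : MemOrlicz A.conj (0 : EuclideanSpace ℝ (Fin d) → F) volume :=
  ⟨aestronglyMeasurable_zero, 1, one_pos, by simp [orliczModular, A.conj_zero]⟩

lemma conj_smul_const {f : EuclideanSpace ℝ (Fin d) → ℝ} (hf : MemOrlicz A.conj f volume) {e : F}
    (he : ‖e‖ ≤ 1) : MemOrlicz A.conj (fun x => f x • e) volume := by
  obtain ⟨hfm, a, ha, hfa⟩ := hf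
  refine ⟨hfm.smul_const e, a, ha, lt_of_le_of_lt (lintegral_mono fun x => A.conj_mono x ?_) hfa⟩
  simp only [Pi.smul_apply, nnnorm_smul, ← mul_assoc, smul_eq_mul, nnnorm_mul]
  exact mul_le_of_le_one_right zero_le he

end MemOrlicz

variable {w : EuclideanSpace ℝ (Fin d) → ℝ}

/-- The density, divided by the weight, lies in `L^{A'}`. By monotonicity of `A(x, ·)`, the value
`A'(x, |g| / w)` is the supremum of `t |g| - A(x, t w)` over a dense sequence of numbers `t`. The
maximum over finitely many of these is attained by a simple function `t`, and then the integral is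
at most `G(± t w) - ∫ A(x, t w) ≤ 1` when `‖G‖ ≤ 1`, because `‖u‖ ≤ 1 + ∫ A(x, |u|)` on `L^A`. -/
lemma memOrlicz_conj_density {q : ℝ} (hA : A.Dec q) (hwm : Measurable w)
    (hw0 : ∀ x, 0 < w x) (hw : MemOrlicz A.toENN w volume)
    {G : StrongDual ℝ (OrliczSpace A ℝ)} {g : EuclideanSpace ℝ (Fin d) → ℝ} (hgm : Measurable g)
    (hg : Integrable g volume)
    (hG : ∀ t : SimpleFunc (EuclideanSpace ℝ (Fin d)) ℝ, G (simpleMul hw t) = ∫ x, g x * t x) :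
    MemOrlicz A.conj (fun x => g x / w x) volume := by
  set ρ : ℝ := (1 + ‖G‖)⁻¹ with hρ
  have hρ0 : 0 < ρ := by positivity
  have hρG : ρ * ‖G‖ ≤ 1 := by
    rw [hρ, inv_mul_le_iff₀ (by positivity)]
    linarith
  refine ⟨(hgm.div hwm).aestronglyMeasurable, ρ, hρ0, ?_⟩
  have hAm : ∀ t : EuclideanSpace ℝ (Fin d) → ℝ, Measurable t →
      AEMeasurable (fun x => A.toFun x ‖t x * w x‖₊) volume := fun t ht =>
    A.aemeasurable_comp _ (ht.mul hwm).nnnorm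
  set V : ℝ → EuclideanSpace ℝ (Fin d) → ℝ :=
    fun c x => ρ * |g x * c| - A.toFun x ‖c * w x‖₊ with hV
  have hVm : ∀ t : EuclideanSpace ℝ (Fin d) → ℝ, Measurable t →
      AEMeasurable (fun x => V (t x) x) volume := fun t ht =>
    ((hgm.mul ht).abs.const_mul ρ).aemeasurable.sub (hAm t ht).coe_nnreal_real
  have hy := TopologicalSpace.denseRange_denseSeq ℝ≥0
  set y := TopologicalSpace.denseSeq ℝ≥0
  -- A simple function at which `V` is a.e. nonnegative and at least its first `n` values.
  have hsel : ∀ n : ℕ, ∃ t : SimpleFunc (EuclideanSpace ℝ (Fin d)) ℝ, ∀ᵐ x,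
      0 ≤ V (t x) x ∧ ∀ i < n, V (y i) x ≤ V (t x) x := by
    intro n
    induction n with
    | zero =>
      refine ⟨0, ?_⟩
      filter_upwards [A.ae_zero] with x hx
      simp [hV, hx]
    | succ n ih =>
      obtain ⟨t, ht⟩ := ih
      -- `A(·, c)` is only a.e.-measurable, hence the measurable modification of the set.
      obtain ⟨B, -, hBm, hB⟩ := (nullMeasurableSet_lt (hVm t t.measurable)
        (hVm (fun _ => y n) measurable_const)).exists_measurable_superset_ae_eq
      refine ⟨SimpleFunc.piecewise B hBm (SimpleFunc.const _ (y n : ℝ)) t, ?_⟩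
      filter_upwards [ht, hB.mem_iff] with x ⟨h1, h2⟩ hx
      rw [SimpleFunc.piecewise_apply]
      by_cases hxB : x ∈ B
      · have h3 : V (t x) x < V (y n) x := hx.1 hxB
        simp only [if_pos hxB, SimpleFunc.const_apply]
        refine ⟨h1.trans h3.le, fun i hi => ?_⟩
        rcases Nat.lt_succ_iff_lt_or_eq.1 hi with hi | rfl
        · exact (h2 i hi).trans h3.le
        · exact le_rfl
      · have h3 : V (y n) x ≤ V (t x) x := not_lt.1 fun h => hxB (hx.2 h)
        simp only [if_neg hxB]
        refine ⟨h1, fun i hi => ?_⟩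
        rcases Nat.lt_succ_iff_lt_or_eq.1 hi with hi | rfl
        · exact h2 i hi
        · exact h3
  -- Subtracting the modular is legitimate because `(Dec)_q` makes it finite.
  have hone : ∀ t : SimpleFunc (EuclideanSpace ℝ (Fin d)) ℝ, (∀ᵐ x, 0 ≤ V (t x) x) →
      ∫⁻ x, ENNReal.ofReal (V (t x) x) ≤ 1 := by
    intro t ht
    set u := simpleMul hw t
    have hmod : orliczModular A.toENN u.fn volume = ∫⁻ x, (A.toFun x ‖t x * w x‖₊ : ℝ≥0∞) :=
      orliczModular_congr (fn_simpleMul hw t)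
    have hfin : orliczModular A.toENN u.fn volume ≠ ∞ := by
      simpa using (hA.modular_smul_lt_top u.fn_memOrlicz 1).ne
    have hnorm := u.norm_le_one_add_modular hfin
    have hsub : ∀ x, ENNReal.ofReal (V (t x) x) =
        ENNReal.ofReal (ρ * |g x * t x|) - (A.toFun x ‖t x * w x‖₊ : ℝ≥0∞) := fun x => by
      rw [hV, ENNReal.ofReal_sub _ (NNReal.coe_nonneg _), ENNReal.ofReal_coe_nnreal]
    simp only [hsub]
    rw [lintegral_sub' (hAm t t.measurable).coe_nnreal_ennreal (hmod ▸ hfin), ← hmod,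
      tsub_le_iff_right]
    · simp only [ENNReal.ofReal_mul hρ0.le]
      rw [lintegral_const_mul' _ _ ENNReal.ofReal_ne_top]
      calc ENNReal.ofReal ρ * ∫⁻ x, ENNReal.ofReal |g x * t x|
          ≤ ENNReal.ofReal ρ * ENNReal.ofReal (‖G‖ * ‖u‖) := by
            gcongr
            exact lintegral_density_mul_le hw hgm hg hG t
        _ = ENNReal.ofReal (ρ * ‖G‖ * ‖u‖) := by rw [← ENNReal.ofReal_mul hρ0.le, mul_assoc]
        _ ≤ ENNReal.ofReal (1 + (orliczModular A.toENN u.fn volume).toReal) := by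
            refine ENNReal.ofReal_le_ofReal (le_trans ?_ hnorm)
            exact mul_le_of_le_one_left (norm_nonneg _) hρG
        _ = 1 + orliczModular A.toENN u.fn volume := by
            rw [ENNReal.ofReal_add zero_le_one ENNReal.toReal_nonneg, ENNReal.ofReal_one,
              ENNReal.ofReal_toReal hfin]
    · filter_upwards [ht] with x hx
      rw [← ENNReal.ofReal_coe_nnreal]
      exact ENNReal.ofReal_le_ofReal (sub_nonneg.1 hx)
  have hconj : ∀ᵐ x, A.conj x ‖(ρ • fun x => g x / w x) x‖₊ ≤
      ⨆ n : ℕ, ⨆ i : Fin n, ENNReal.ofReal (V (y i) x) := by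
    filter_upwards [A.ae_monotone] with x hm
    have hwx : ‖w x‖₊ ≠ 0 := by simpa using (hw0 x).ne'
    rw [PhiFunction.conj_eq_iSup hm hwx hy]
    refine iSup_le fun n => le_iSup_of_le (n + 1) (le_iSup_of_le (Fin.last n) (le_of_eq ?_))
    congr 1
    have hwx' : |w x| ≠ 0 := by simpa using (hw0 x).ne'
    have hyw : ‖(y n : ℝ) * w x‖₊ = y n * ‖w x‖₊ := by simp [nnnorm_mul]
    simp only [hV, Fin.val_last, hyw, Pi.smul_apply, smul_eq_mul,
      NNReal.coe_mul, coe_nnnorm, Real.norm_eq_abs, abs_mul, abs_div, abs_of_pos hρ0,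
      NNReal.abs_eq]
    field_simp
  refine lt_of_le_of_lt ((lintegral_mono_ae hconj).trans ?_) ENNReal.one_lt_top
  have hVy : ∀ i, AEMeasurable (fun x => ENNReal.ofReal (V (y i) x)) volume :=
    fun i => (hVm (fun _ => y i) measurable_const).ennreal_ofReal
  have hmono : ∀ x, Monotone fun n : ℕ => ⨆ i : Fin n, ENNReal.ofReal (V (y i) x) :=
    fun x n m hnm => iSup_le fun i =>
      le_iSup (fun j : Fin m => ENNReal.ofReal (V (y j) x)) (Fin.castLE hnm i)
  rw [lintegral_iSup' (fun n => .iSup fun i : Fin n => hVy i) (Eventually.of_forall hmono)]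
  refine iSup_le fun n => ?_
  obtain ⟨t, ht⟩ := hsel n
  refine le_trans (lintegral_mono_ae ?_) (hone t (ht.mono fun x hx => hx.1))
  filter_upwards [ht] with x hx
  exact iSup_le fun i => ENNReal.ofReal_le_ofReal (hx.2 i i.2)

/-- Riesz representation on scalar `L^A` under `(Dec)_q`: every continuous functional is given by
a function in `L^{A'}`. -/
theorem exists_representation_scalar {q : ℝ} (hA : A.Dec q) (G : StrongDual ℝ (OrliczSpace A ℝ)) :
    ∃ f : EuclideanSpace ℝ (Fin d) → ℝ, MemOrlicz A.conj f volume ∧ ∀ u : OrliczSpace A ℝ,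
      Integrable (fun x => f x * u.fn x) volume ∧ G u = ∫ x, f x * u.fn x := by
  obtain ⟨w, hwm, hw0, hw⟩ := A.exists_pos_memOrlicz
  obtain ⟨g, hgm, hg, hG⟩ := exists_density hA hw G
  exact ⟨fun x => g x / w x, memOrlicz_conj_density hA hwm hw0 hw hgm hg hG,
    integrable_and_apply_eq_integral hA hwm hw0 hw hgm hg hG⟩

end Conjugate

/-! ### Functionals on vector-valued `L^A` -/

section Vector

variable {d : ℕ} {A : PhiFunction d}

namespace OrliczSpace

variable {F : Type*} [NormedAddCommGroup F] [NormedSpace ℝ F]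

lemma fn_sum {ι : Type*} (s : Finset ι) (f : ι → OrliczSpace A F) :
    (∑ i ∈ s, f i).fn =ᵐ[volume] fun x => ∑ i ∈ s, (f i).fn x := by
  classical
  induction s using Finset.induction_on with
  | empty =>
    filter_upwards [fn_zero (A := A) (F := F)] with x hx
    simpa using hx
  | insert i s hi ih =>
    rw [Finset.sum_insert hi]
    filter_upwards [fn_add (f i) (∑ i ∈ s, f i), ih] with x h1 h2
    rw [h1, Pi.add_apply, h2, Finset.sum_insert hi]

lemma memOrlicz_smul_const (u : OrliczSpace A ℝ) (e : F) :
    MemOrlicz A.toENN (fun x => u.fn x • e) volume := by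
  refine PhiFunction.memOrlicz_of_le (‖e‖ • u).fn_memOrlicz
    (u.fn_stronglyMeasurable.aestronglyMeasurable.smul_const e) ?_
  filter_upwards [fn_smul ‖e‖ u] with x h
  rw [h, Pi.smul_apply, norm_smul, norm_smul, norm_norm, mul_comm]

/-- The map `u ↦ u e` from scalar to vector-valued `L^A`, for a fixed vector `e`. -/
def smulRight (e : F) : OrliczSpace A ℝ →L[ℝ] OrliczSpace A F :=
  LinearMap.mkContinuous
    { toFun := fun u => ofFun _ (memOrlicz_smul_const u e)
      map_add' := fun u v => by
        refine ext_fn ?_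
        filter_upwards [fn_add (ofFun _ (memOrlicz_smul_const u e))
          (ofFun _ (memOrlicz_smul_const v e)), fn_ofFun (memOrlicz_smul_const u e),
          fn_ofFun (memOrlicz_smul_const v e), fn_ofFun (memOrlicz_smul_const (u + v) e),
          fn_add u v] with x h1 h2 h3 h4 h5
        rw [h4, h1, Pi.add_apply, h2, h3, h5, Pi.add_apply, add_smul]
      map_smul' := fun c u => by
        refine ext_fn ?_
        filter_upwards [fn_smul c (ofFun _ (memOrlicz_smul_const u e)),
          fn_ofFun (memOrlicz_smul_const u e), fn_ofFun (memOrlicz_smul_const (c • u) e),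
          fn_smul c u] with x h1 h2 h3 h4
        rw [h3, RingHom.id_apply, h1, Pi.smul_apply, h2, h4, Pi.smul_apply, smul_assoc] }
    ‖e‖ fun u => by
      have h : ‖ofFun _ (memOrlicz_smul_const u e)‖ ≤ ‖‖e‖ • u‖ := by
        refine norm_le_norm_of_ae_le ?_
        filter_upwards [fn_ofFun (memOrlicz_smul_const u e), fn_smul ‖e‖ u] with x h1 h2
        rw [h1, h2, Pi.smul_apply, norm_smul, norm_smul, norm_norm, mul_comm]
      rwa [norm_smul, norm_norm] at h

lemma fn_smulRight (e : F) (u : OrliczSpace A ℝ) :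
    (smulRight e u).fn =ᵐ[volume] fun x => u.fn x • e :=
  fn_ofFun (memOrlicz_smul_const u e)

lemma memOrlicz_coord {m : ℕ} (h : OrliczSpace A (EuclideanSpace ℝ (Fin m))) (i : Fin m) :
    MemOrlicz A.toENN (fun x => h.fn x i) volume := by
  refine PhiFunction.memOrlicz_of_le h.fn_memOrlicz ?_
    (Eventually.of_forall fun x => PiLp.norm_apply_le _ i)
  exact (((EuclideanSpace.proj i : EuclideanSpace ℝ (Fin m) →L[ℝ] ℝ).continuous).comp_stronglyMeasurable
    h.fn_stronglyMeasurable).aestronglyMeasurable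

lemma sum_smulRight_coord {m : ℕ} (h : OrliczSpace A (EuclideanSpace ℝ (Fin m))) :
    ∑ i, smulRight (EuclideanSpace.single i (1 : ℝ)) (ofFun _ (memOrlicz_coord h i)) = h := by
  refine ext_fn ?_
  filter_upwards [fn_sum Finset.univ fun i =>
      smulRight (EuclideanSpace.single i (1 : ℝ)) (ofFun _ (memOrlicz_coord h i)),
    ae_all_iff.2 fun i => fn_smulRight (EuclideanSpace.single i (1 : ℝ))
      (ofFun _ (memOrlicz_coord h i)),
    ae_all_iff.2 fun i => fn_ofFun (memOrlicz_coord h i)] with x h1 h2 h3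
  rw [h1]
  simp only [h2, h3]
  ext j
  simp [Finset.sum_apply, Pi.single_apply]

end OrliczSpace

/-- Riesz representation on vector-valued `L^A` under `(Dec)_q`, coordinate by coordinate. -/
theorem exists_representation_vector {q : ℝ} (hA : A.Dec q) {m : ℕ}
    (G : StrongDual ℝ (OrliczSpace A (EuclideanSpace ℝ (Fin m)))) :
    ∃ v : EuclideanSpace ℝ (Fin d) → EuclideanSpace ℝ (Fin m), MemOrlicz A.conj v volume ∧
      ∀ h : OrliczSpace A (EuclideanSpace ℝ (Fin m)),
        Integrable (fun x => inner ℝ (v x) (h.fn x)) volume ∧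
          G h = ∫ x, inner ℝ (v x) (h.fn x) := by
  choose f hf hfu using fun i : Fin m => exists_representation_scalar hA
    (G.comp (OrliczSpace.smulRight (EuclideanSpace.single i (1 : ℝ))))
  refine ⟨∑ i, fun x => f i x • EuclideanSpace.single i (1 : ℝ), ?_, fun h => ?_⟩
  · exact Finset.sum_induction _ (fun v => MemOrlicz A.conj v volume)
      (fun _ _ => MemOrlicz.conj_add) MemOrlicz.conj_zero
      fun i _ => (hf i).conj_smul_const (by simp)
  have hinner : (fun x => inner ℝ ((∑ i, fun x => f i x • EuclideanSpace.single i (1 : ℝ)) x)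
      (h.fn x)) = fun x => ∑ i, f i x * h.fn x i := by
    ext x
    simp [Finset.sum_apply, sum_inner, inner_smul_left, EuclideanSpace.inner_single_left]
  have hae : ∀ i, (fun x => f i x * (OrliczSpace.ofFun _ (h.memOrlicz_coord i)).fn x) =ᵐ[volume]
      fun x => f i x * h.fn x i := fun i => by
    filter_upwards [OrliczSpace.fn_ofFun (h.memOrlicz_coord i)] with x hx
    rw [hx]
  have hint : ∀ i, Integrable (fun x => f i x * h.fn x i) volume := fun i =>
    (hfu i _).1.congr (hae i)
  rw [hinner]
  refine ⟨integrable_finsetSum _ fun i _ => hint i, ?_⟩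
  rw [integral_finsetSum _ fun i _ => hint i]
  nth_rewrite 1 [← h.sum_smulRight_coord]
  rw [map_sum]
  exact Finset.sum_congr rfl fun i _ => (hfu i _).2.trans (integral_congr_ae (hae i))

end Vector

/-! ### The dual of the fractional Sobolev-Orlicz space -/

namespace FracSobolevOrlicz

variable {d : ℕ} {s : ℝ} {A : PhiFunction d}
  {Ω : TopologicalSpace.Opens (EuclideanSpace ℝ (Fin d))}

/-- Test functions vanish off `Ω`, and this passes to limits because `|g| ≤ |g - φ|` off `Ω`. -/
lemma ae_eq_zero_of_notMem (g : FracSobolevOrlicz s A Ω) :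
    ∀ᵐ x, x ∉ Ω → g.toOrlicz.fn x = 0 := by
  have hmem : MemOrlicz A.toENN ((Ω : Set (EuclideanSpace ℝ (Fin d)))ᶜ.indicator g.toOrlicz.fn)
      volume := by
    refine PhiFunction.memOrlicz_of_le g.toOrlicz.fn_memOrlicz
      (g.toOrlicz.fn_stronglyMeasurable.indicator Ω.isOpen.measurableSet.compl).aestronglyMeasurable
      (Eventually.of_forall fun x => norm_indicator_le_norm_self _ _)
  have hzero : OrliczSpace.ofFun _ hmem = 0 := by
    rw [← norm_le_zero_iff]
    refine le_of_forall_pos_le_add fun ε hε => ?_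
    obtain ⟨p, ⟨φ, hφ, -⟩, hp⟩ := Metric.mem_closure_iff.1 g.2 ε hε
    rw [zero_add]
    have h1 : ‖OrliczSpace.ofFun _ hmem‖ ≤ ‖g.toOrlicz - p.fst‖ := by
      refine OrliczSpace.norm_le_norm_of_ae_le ?_
      filter_upwards [OrliczSpace.fn_ofFun hmem, OrliczSpace.fn_sub g.toOrlicz p.fst, hφ]
        with x h1 h2 h3
      rw [h1, h2, Pi.sub_apply, h3]
      by_cases hx : x ∈ Ω
      · simp [hx]
      · have : φ x = 0 := image_eq_zero_of_notMem_tsupport fun h => hx (φ.tsupport_subset h)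
        simp [hx, this]
    have h2 : ‖g.toOrlicz - p.fst‖ ≤ dist (g : WithLp 1 _) p := by
      rw [dist_eq_norm, WithLp.prod_norm_eq_of_L1]
      exact le_add_of_nonneg_right (norm_nonneg _)
    exact h1.trans (h2.trans hp.le)
  filter_upwards [OrliczSpace.fn_ofFun hmem, OrliczSpace.fn_zero (A := A) (F := ℝ)] with x h1 h2 hx
  rw [hzero, h2, indicator_of_mem (by simpa using hx)] at h1
  exact h1.symm

end FracSobolevOrlicz

end

theorem mainTheorem11 {d : ℕ} (Ω : TopologicalSpace.Opens (EuclideanSpace ℝ (Fin d)))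
    (s : ℝ) (hs : s ∈ Set.Ioc (0 : ℝ) 1) (A : PhiFunction d) (q : ℝ) (hA : A.Dec q)
    (F : FracSobolevOrliczDual s A Ω) :
    ∃ (f : EuclideanSpace ℝ (Fin d) → ℝ)
      (v : EuclideanSpace ℝ (Fin d) → EuclideanSpace ℝ (Fin d)),
      MemOrlicz A.conj f (volume.restrict (Ω : Set (EuclideanSpace ℝ (Fin d)))) ∧
      MemOrlicz A.conj v volume ∧
      ∀ g : FracSobolevOrlicz s A Ω,
        IntegrableOn (fun x => f x * g.toOrlicz.fn x) (Ω : Set (EuclideanSpace ℝ (Fin d))) volume ∧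
        Integrable (fun x => inner ℝ (v x) (g.grad.fn x)) volume ∧
        F g = (∫ x in (Ω : Set (EuclideanSpace ℝ (Fin d))), f x * g.toOrlicz.fn x) +
          ∫ x, inner ℝ (v x) (g.grad.fn x) := by
  obtain ⟨G, hG, -⟩ := exists_extension_norm_eq (testGraph s A Ω).topologicalClosure F
  set e := (WithLp.prodContinuousLinearEquiv 1 ℝ (OrliczSpace A ℝ)
    (OrliczSpace A (EuclideanSpace ℝ (Fin d)))).symm
  obtain ⟨f, hf, hfu⟩ := exists_representation_scalar hA
    ((G.comp e.toContinuousLinearMap).comp (ContinuousLinearMap.inl ℝ _ _))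
  obtain ⟨v, hv, hvh⟩ := exists_representation_vector hA
    ((G.comp e.toContinuousLinearMap).comp (ContinuousLinearMap.inr ℝ _ _))
  refine ⟨f, v, ?_, hv, fun g => ⟨(hfu g.toOrlicz).1.integrableOn, (hvh g.grad).1, ?_⟩⟩
  · obtain ⟨hfm, ρ, hρ, hfin⟩ := hf
    exact ⟨hfm.restrict, ρ, hρ, (lintegral_mono' Measure.restrict_le_self le_rfl).trans_lt hfin⟩
  -- `g` vanishes off `Ω`, so the scalar pairing over `ℝ^d` is the one over `Ω`.
  have hΩ : ∫ x in (Ω : Set (EuclideanSpace ℝ (Fin d))), f x * g.toOrlicz.fn x =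
      ∫ x, f x * g.toOrlicz.fn x := by
    refine setIntegral_eq_integral_of_ae_compl_eq_zero ?_
    filter_upwards [g.ae_eq_zero_of_notMem] with x hx hxΩ
    rw [hx hxΩ, mul_zero]
  rw [hΩ, ← (hfu g.toOrlicz).2, ← (hvh g.grad).2, ← hG g]
  simp only [ContinuousLinearMap.comp_apply]
  rw [← map_add, ← map_add]
  congr 1
  simp only [ContinuousLinearMap.inl_apply, ContinuousLinearMap.inr_apply, Prod.mk_add_mk,
    add_zero, zero_add]
  rfl
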